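/- A compact matrix quantum group $G$ of size $N$ is given by a unital $C^*$-algebra $A=C(G)$ generated by the entries of a unitary matrix $u=(u_{ij})\in M_N(A)$, such that the formulae $\Delta(u_{ij})=\sum_k u_{ik}\otimes u_{kj}$, $\varepsilon(u_{ij})=\delta_{ij}$, $S(u_{ij})=u_{ji}^*$ define morphisms of $C^*$-algebras $\Delta:A\to A\otimes A$ (minimal tensor product), $\varepsilon:A\to\mathbb C$, $S:A\to A^{opp}$. Its Haar integration $\int_G:C(G)\to\mathbb C$ is the unique state satisfying $(\int_G\otimes id)\Delta(x)=(id\otimes\int_G)\Delta(x)=\int_G(x)1$ for all $x$. Let $K\geq1$. We write $G\subset U_{N,K}^*$ when the coordinates $u_{ij}$ of $G$ satisfy the defining relations of $U_{N,K}^*$, namely: (1) The matrices $u=(u_{ij})$ and $\bar u=(u_{ij}^*)$ are both unitary. (2) The elements $ab^*$ and $a^*b$, with $a,b\in\{u_{ij}\}$, all commute. (3) $a_1\cdots a_K\cdot b_1\cdots b_K=b_1\cdots b_K\cdot a_1\cdots a_K$, for any $a_r,b_r\in\{u_{ij},u_{ij}^*\}$ such that in each of the words $a_1\cdots a_K$ and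 $b_1\cdots b_K$ the number of letters $u_{ij}$ minus the number of letters $u_{ij}^*$ is a multiple of $K$ (which is automatic for $K=1,2$). **Proposition 4.6.** Let $G\subset U_{N,K}^*$ be $K$-symmetric, in the sense that $u_{ij}\to e^{2\pi i/K}u_{ij}$ defines an automorphism of $C(G)$. Then there is a closed subgroup $L\subset U_N^K$, stable under the action $\mathbb Z_K\curvearrowright U_N^K$ by cyclic permutations of the factors, and a $*$-homomorphism $$\pi:C(G)\to M_K(C(L)),\qquad u_{ij}\to\tau[v_{ij}^{(1)},\ldots,v_{ij}^{(K)}]$$ which is stationary, in the sense that $\int_G=\left(tr\otimes\int_L\right)\pi$, where $tr$ is the normalized trace of $M_K(\mathbb C)$ and $\int_L$ is the integration with respect to the Haar probability measure of $L$. Here $v_{ij}^{(r)}\in C(L)$ is the $(i,j)$ entry of the $r$-th component of the elements of $L\subset U_N^K$, and $\tau[x_1,\ldots,x_K]$ is the $K\times K$ matrix with $x_1$ at position $(1,K)$, with $x_r$ at position $(r,r-1)$ for $2\leq r\leq K$, and with all other entries $0$. -/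

import Mathlib

open scoped TensorProduct ComplexOrder
open MeasureTheory

noncomputable section

namespace QGroup

section Spatial

variable {A : Type*} [CStarAlgebra A]

/-- A state on a unital C*-algebra: a unital positive (bounded) linear functional. -/
def IsState (φ : A →L[ℂ] ℂ) : Prop :=
  φ 1 = 1 ∧ ∀ a : A, 0 ≤ φ (star a * a)

/-- The product functional `φ ⊗ ψ` on the algebraic tensor product. -/
def prodFunctional (φ ψ : A →L[ℂ] ℂ) : A ⊗[ℂ] A →ₗ[ℂ] ℂ :=
  LinearMap.mul' ℂ ℂ ∘ₗ TensorProduct.map (φ : A →ₗ[ℂ] ℂ) (ψ : A →ₗ[ℂ] ℂ)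

/-- The spatial (minimal) C*-norm on the algebraic tensor product `A ⊗ A`: the supremum of the
operator norms of `t` in the GNS representations `π_φ ⊗ π_ψ` of all product states, that is,
the supremum of the numbers `((φ ⊗ ψ) (s* t* t s)) ^ (1/2)` with `(φ ⊗ ψ) (s* s) ≤ 1`.
(It takes values in `[0, ∞]` so that the supremum carries no junk value.) -/
def spatialNorm (t : A ⊗[ℂ] A) : ENNReal :=
  ⨆ (φ : A →L[ℂ] ℂ) (_ : IsState φ) (ψ : A →L[ℂ] ℂ) (_ : IsState ψ)
    (s : A ⊗[ℂ] A) (_ : (prodFunctional φ ψ (star s * s)).re ≤ 1),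
    ENNReal.ofReal (Real.sqrt (prodFunctional φ ψ (star (t * s) * (t * s))).re)

end Spatial

/-- The `*`-algebra generated by the entries of a matrix `u` over `A`. -/
def coordAlg {N : ℕ} {A : Type*} [CStarAlgebra A] (u : Matrix (Fin N) (Fin N) A) :
    StarSubalgebra ℂ A :=
  StarAlgebra.adjoin ℂ {a : A | ∃ i j, a = u i j}

/-- The `(i, j)` coordinate, as an element of the `*`-algebra generated by the coordinates. -/
def coord {N : ℕ} {A : Type*} [CStarAlgebra A] (u : Matrix (Fin N) (Fin N) A) (i j : Fin N) :
    coordAlg u :=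
  ⟨u i j, StarAlgebra.subset_adjoin ℂ _ ⟨i, j, rfl⟩⟩

/-- A compact matrix quantum group `G` with `C(G) = A` and `N × N` fundamental corepresentation
`u`: the algebra `A` is generated by the entries of the unitary `u`, and the formulae
`Δ(u_ij) = ∑ u_ik ⊗ u_kj`, `ε(u_ij) = δ_ij`, `S(u_ij) = u_ji*` define morphisms of C*-algebras
`Δ : A → A ⊗ A` (spatial tensor product), `ε : A → ℂ`, `S : A → Aᵒᵖ`.

The map `Δ` is recorded on the dense `*`-algebra generated by the coordinates, where it takes
values in the algebraic tensor product; being a morphism of C*-algebras into the completion of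
`A ⊗ A` for the spatial norm means that it is a `*`-homomorphism which is contractive for that
norm.  All these maps are uniquely determined by `u`. -/
structure CompactMatrixQuantumGroup (N : ℕ) (A : Type*) [CStarAlgebra A] where
  u : Matrix (Fin N) (Fin N) A
  unitary_u : u ∈ unitary (Matrix (Fin N) (Fin N) A)
  dense_coord : (coordAlg u).topologicalClosure = ⊤
  comul : coordAlg u →⋆ₐ[ℂ] A ⊗[ℂ] A
  comul_coord : ∀ i j, comul (coord u i j) = ∑ k, u i k ⊗ₜ[ℂ] u k j
  comul_le : ∀ x : coordAlg u, spatialNorm (comul x) ≤ ENNReal.ofReal ‖(x : A)‖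
  counit : A →⋆ₐ[ℂ] ℂ
  counit_coord : ∀ i j, counit (u i j) = if i = j then 1 else 0
  antipode : A →⋆ₐ[ℂ] Aᵐᵒᵖ
  antipode_coord : ∀ i j, antipode (u i j) = MulOpposite.op (star (u j i))

namespace CompactMatrixQuantumGroup

variable {N : ℕ} {A : Type*} [CStarAlgebra A] (G : CompactMatrixQuantumGroup N A)

/-- The Haar integration of `G`: the (unique) state `h` of `C(G)` with
`(h ⊗ id) Δ(x) = h(x) 1 = (id ⊗ h) Δ(x)` on the dense algebra generated by the coordinates,
and so, by continuity, everywhere. -/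
def IsHaarState (h : A →L[ℂ] ℂ) : Prop :=
  IsState h ∧ ∀ x : coordAlg G.u,
    TensorProduct.lid ℂ A (LinearMap.rTensor A (h : A →ₗ[ℂ] ℂ) (G.comul x)) = h x • (1 : A) ∧
    TensorProduct.rid ℂ A (LinearMap.lTensor A (h : A →ₗ[ℂ] ℂ) (G.comul x)) = h x • (1 : A)

/-- The closed subgroup condition `G ⊆ U_N^*` (half-liberated unitary group), i.e. the coordinates
satisfy the relations which define `C(U_N^*)` as a universal C*-algebra: the matrices `u = (u_ij)`
and `(u_ij*)` are unitary, and the elements `a b*`, `a* b`, with `a, b` among the `u_ij`,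
all commute. -/
def IsHalfLiberatedUnitary : Prop :=
  G.u ∈ unitary (Matrix (Fin N) (Fin N) A) ∧
  G.u.map star ∈ unitary (Matrix (Fin N) (Fin N) A) ∧
  ∀ x ∈ {x : A | ∃ i j k l, x = G.u i j * star (G.u k l) ∨ x = star (G.u i j) * G.u k l},
  ∀ y ∈ {x : A | ∃ i j k l, x = G.u i j * star (G.u k l) ∨ x = star (G.u i j) * G.u k l},
    Commute x y

/-- The letter `u_ij` (for `(false, i, j)`) or `u_ij*` (for `(true, i, j)`). -/
def letter (s : Bool × Fin N × Fin N) : A :=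
  if s.1 then star (G.u s.2.1 s.2.2) else G.u s.2.1 s.2.2

/-- The product `a_1 a_2 ⋯ a_K` of the letters of a word. -/
def wordVal {K : ℕ} (w : Fin K → Bool × Fin N × Fin N) : A :=
  (List.ofFn fun t => G.letter (w t)).prod

/-- The degree of a word: the number of its letters `u_ij` minus the number of its
letters `u_ij*`. -/
def wordDegree {K : ℕ} (w : Fin K → Bool × Fin N × Fin N) : ℤ :=
  ∑ t, if (w t).1 then -1 else 1

/-- The closed subgroup condition `G ⊆ U_{N,K}^*`, where `U_{N,K}^* ⊆ U_N^*` is obtained by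
imposing the length `2K` relations `a_1 ⋯ a_K · b_1 ⋯ b_K = b_1 ⋯ b_K · a_1 ⋯ a_K`, for
words `a_1 ⋯ a_K` and `b_1 ⋯ b_K` in the `u_ij, u_ij*` whose degrees are multiples of `K`.
For `K = 1, 2` the degree condition is automatic, so that these are the relations `ab = ba`
(giving `U_N`) and `ab·cd = cd·ab` (giving `U_N^{**}`), for arbitrary letters. -/
def IsArithmeticHalfLiberated (K : ℕ) : Prop :=
  G.IsHalfLiberatedUnitary ∧
  ∀ v w : Fin K → Bool × Fin N × Fin N,
    (K : ℤ) ∣ wordDegree v → (K : ℤ) ∣ wordDegree w →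
      G.wordVal v * G.wordVal w = G.wordVal w * G.wordVal v

/-- `G` is `K`-symmetric: `u_ij ↦ e^{2πi/K} u_ij` defines an automorphism of `C(G)`. -/
def IsSymmetric (K : ℕ) : Prop :=
  ∃ α : A ≃⋆ₐ[ℂ] A, ∀ i j,
    α (G.u i j) = Complex.exp (2 * Real.pi * Complex.I / K) • G.u i j

/-- A matrix model `π : C(G) → M_K(C(X))`, with `X` a probability space with measure `μ`, is
stationary: the Haar integration of `G` equals `(tr ⊗ ∫_X) π`, with `tr` the normalized trace. -/
def IsStationary {K : ℕ} {X : Type*} [TopologicalSpace X] [MeasurableSpace X] (μ : Measure X)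
    (π : A →⋆ₐ[ℂ] Matrix (Fin K) (Fin K) C(X, ℂ)) : Prop :=
  ∃ h : A →L[ℂ] ℂ, G.IsHaarState h ∧
    ∀ a : A, h a = (K : ℂ)⁻¹ * ∑ r, ∫ x, π a r r x ∂μ

end CompactMatrixQuantumGroup

/-- The group `U_N^K`. -/
abbrev UnitaryPow (N K : ℕ) : Type := Fin K → Matrix.unitaryGroup (Fin N) ℂ

/-- `L ⊆ U_N^K` is stable under the action of `ℤ_K` by cyclic permutations of the factors. -/
def IsCyclicStable {N K : ℕ} (L : Subgroup (UnitaryPow N K)) : Prop :=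
  ∀ g ∈ L, (fun r => g (finRotate K r)) ∈ L

/-- The function `v_ij^{(r)} ∈ C(L)`: the `(i, j)` entry of the `r`-th component. -/
def component {N K : ℕ} (L : Subgroup (UnitaryPow N K)) (r : Fin K) (i j : Fin N) : C(L, ℂ) where
  toFun g := ((g : UnitaryPow N K) r : Matrix (Fin N) (Fin N) ℂ) i j
  continuous_toFun := by
    have h : Continuous fun g : L => ((g : UnitaryPow N K) r : Matrix (Fin N) (Fin N) ℂ) :=
      continuous_subtype_val.comp ((continuous_apply r).comp continuous_subtype_val)
    exact h.matrix_elem i j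

/-- `τ[x_1, …, x_K]`: the standard `K`-cycle filled with `x_1, …, x_K`, with `x_r` in row `r`,
at the column which cyclically precedes `r` (so `x_1` is in the top right corner, and
`x_2, …, x_K` are below the diagonal). -/
def cycleMatrix {R : Type*} [Zero R] {K : ℕ} (x : Fin K → R) : Matrix (Fin K) (Fin K) R :=
  fun r c => if r = finRotate K c then x r else 0

end QGroup

end

/-! The automorphism `α` scaling the coordinates by `ω = e^{2πi/K}` grades `A = C(G)` by `ℤ/K`. The
degree-zero part `A₀` is commutative (`commute_of_mem_grade_zero`). Unitarity and the length-`2K`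
relations bring every word to the form `u⋯u u*⋯u*`, and a word of this form in degree zero is a
product of pure words of length `K`, which commute.

Let `χ` be a character of `A₀`, and `θ` its composition with the projection onto `A₀`. In the GNS
space of `θ` each degree is a line, so `A` acts on `ℂ^K`, with `u_ij` shifting the basis cyclically
(`exists_rep_of_theta`). By Gelfand theory such cyclic representations separate `A₀`, and a single
diagonal coefficient suffices (`eq_zero_of_forall_isCyclicRep`).

A cyclic representation is the same as a point of `U_N^K`. The points that occur form `L`. Products
come from compressing `(ρ ⊗ ρ')Δ` to the span of the `e_s ⊗ e_s` (`IsModel.exists_mul`), inverses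
from the antipode, cyclic stability from conjugation by the shift, and closedness from limits of
representations. Evaluation at the points of `L` is the model.

For stationarity, put `h_r(a) = ∫_L ρ_g(a)_{rr}`. This is `α`-invariant and `(α ⊗ α⁻¹)Δ = Δ`, so
both slices of `Δ(x)` by `h_r` lie in `A₀`. The invariance of `h_r` can therefore be tested on
diagonal coefficients, where it becomes translation invariance of Haar measure
(`isHaarState_diagIntegral`). Averaging over `r` gives `tr ⊗ ∫_L`. -/

noncomputable section

namespace QGroup

/-! ### The `ℤ/K`-grading defined by the automorphism. -/

section Grading

variable {A : Type*} [CStarAlgebra A] (α : A ≃⋆ₐ[ℂ] A) (ω : ℂ) (K : ℕ)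

/-- The spectral subspace of degree `n` of the automorphism `α`. -/
def grade (n : ℤ) : Submodule ℂ A where
  carrier := {a | α a = ω ^ n • a}
  add_mem' {a b} ha hb := by
    simp only [Set.mem_ofPred_eq] at ha hb ⊢
    rw [map_add, ha, hb, smul_add]
  zero_mem' := by simp
  smul_mem' c a ha := by
    simp only [Set.mem_ofPred_eq] at ha ⊢
    rw [map_smul, ha, smul_comm]

/-- The projection onto the spectral subspace of degree `n`, obtained by averaging. -/
def gradeProj (n : ℤ) : A →ₗ[ℂ] A :=
  (K : ℂ)⁻¹ • ∑ k ∈ Finset.range K,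
    ω ^ (-(n * k)) • (((α : A →⋆ₐ[ℂ] A).toAlgHom.toLinearMap : Module.End ℂ A) ^ k)

variable {α ω K}

lemma mem_grade {n : ℤ} {a : A} : a ∈ grade α ω n ↔ α a = ω ^ n • a := Iff.rfl

lemma gradeProj_apply (n : ℤ) (a : A) :
    gradeProj α ω K n a =
      (K : ℂ)⁻¹ • ∑ k ∈ Finset.range K, ω ^ (-(n * k)) • (α^[k] a) := by
  simp only [gradeProj, LinearMap.smul_apply, LinearMap.sum_apply, Module.End.pow_apply]
  rfl

lemma mul_mem_grade (hω : ω ≠ 0) {m n : ℤ} {a b : A} (ha : a ∈ grade α ω m)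
    (hb : b ∈ grade α ω n) : a * b ∈ grade α ω (m + n) := by
  rw [mem_grade] at *
  rw [map_mul, ha, hb, smul_mul_smul_comm, zpow_add₀ hω]

lemma star_mem_grade (hω : ‖ω‖ = 1) {n : ℤ} {a : A} (ha : a ∈ grade α ω n) :
    star a ∈ grade α ω (-n) := by
  rw [mem_grade] at *
  have h1 : star ω = ω⁻¹ := by
    rw [Complex.inv_def, Complex.normSq_eq_norm_sq, hω]; simp
  rw [map_star, ha, star_smul, star_zpow₀, h1, inv_zpow']

lemma one_mem_grade : (1 : A) ∈ grade α ω 0 := by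
  simp [mem_grade]

lemma grade_congr (hω : IsPrimitiveRoot ω K) {m n : ℤ} (h : (K : ℤ) ∣ m - n) :
    grade α ω m = grade α ω n := by
  have h0 : ω ^ m = ω ^ n := by
    obtain ⟨j, hj⟩ := h
    rcases Nat.eq_zero_or_pos K with rfl | hK
    · simp at hj; rw [sub_eq_zero.1 hj]
    have hne : ω ≠ 0 := hω.ne_zero hK.ne'
    rw [show m = n + K * j by linarith, zpow_add₀ hne, zpow_mul, zpow_natCast, hω.pow_eq_one]
    simp
  ext a
  rw [mem_grade, mem_grade, h0]

lemma iterate_of_mem_grade {n : ℤ} {a : A} (ha : a ∈ grade α ω n) (k : ℕ) :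
    α^[k] a = ω ^ (n * k) • a := by
  induction k with
  | zero => simp
  | succ k ih =>
    rw [Function.iterate_succ_apply', ih, map_smul, mem_grade.1 ha, smul_smul]
    by_cases hω : ω = 0
    · subst hω
      by_cases hn : n = 0
      · simp [hn]
      · rw [zero_zpow n hn]
        rw [zero_zpow (n * (k + 1 : ℕ)) (mul_ne_zero hn (by positivity))]; simp
    · rw [← zpow_add₀ hω]; push_cast; ring_nf

lemma sum_zpow_range (hω : IsPrimitiveRoot ω K) (n : ℤ) :
    ∑ k ∈ Finset.range K, ω ^ (n * k) = if (K : ℤ) ∣ n then (K : ℂ) else 0 := by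
  have hpow : ∀ k : ℕ, ω ^ (n * k) = (ω ^ n) ^ k := fun k => by rw [zpow_mul, zpow_natCast]
  simp only [hpow]
  split_ifs with h
  · obtain ⟨j, rfl⟩ := h
    rw [zpow_mul, zpow_natCast, hω.pow_eq_one]; simp
  · have h1 : ω ^ n ≠ 1 := fun h1 => h ((hω.zpow_eq_one_iff_dvd n).1 h1)
    have h2 : (ω ^ n) ^ K = 1 := by
      rw [← zpow_natCast, ← zpow_mul, mul_comm, zpow_mul, zpow_natCast, hω.pow_eq_one, one_zpow]
    rw [geom_sum_eq h1, h2]; simp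

lemma gradeProj_of_mem_grade (hK : K ≠ 0) (hω : IsPrimitiveRoot ω K) {m n : ℤ} {a : A}
    (ha : a ∈ grade α ω m) :
    gradeProj α ω K n a = if (K : ℤ) ∣ m - n then a else 0 := by
  have hne : ω ≠ 0 := hω.ne_zero hK
  have hKc : (K : ℂ) ≠ 0 := by exact_mod_cast hK
  rw [gradeProj_apply]
  simp only [iterate_of_mem_grade ha, smul_smul, ← zpow_add₀ hne]
  rw [← Finset.sum_smul]
  have : ∀ k : ℕ, -(n * (k : ℤ)) + m * k = (m - n) * k := fun k => by ring
  simp only [this, sum_zpow_range hω]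
  split_ifs <;> simp [smul_smul, hKc]

lemma gradeProj_mem (hK : K ≠ 0) (hω : IsPrimitiveRoot ω K) (hα : ∀ a, α^[K] a = a)
    (n : ℤ) (a : A) : gradeProj α ω K n a ∈ grade α ω n := by
  have hne : ω ≠ 0 := hω.ne_zero hK
  rw [mem_grade, gradeProj_apply, map_smul, smul_comm, map_sum]
  congr 1
  have h1 : ∀ k : ℕ, α (ω ^ (-(n * k)) • α^[k] a) =
      ω ^ n • (ω ^ (-(n * ((k + 1 : ℕ) : ℤ))) • α^[k + 1] a) := fun k => by
    rw [map_smul, Function.iterate_succ_apply', smul_smul, ← zpow_add₀ hne]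
    push_cast; ring_nf
  simp only [h1]
  rw [← Finset.smul_sum]
  congr 1
  -- Shifting `k` by one is harmless: the end terms `k = 0` and `k = K` agree, as `ω^K = 1` and `α^K
  -- = id`.
  have h2 := Finset.sum_range_succ (fun k : ℕ => ω ^ (-(n * (k : ℤ))) • α^[k] a) K
  rw [Finset.sum_range_succ'] at h2
  have h3 : ω ^ (-(n * (K : ℤ))) = 1 := by
    rw [hω.zpow_eq_one_iff_dvd]; exact (dvd_mul_left _ _).neg_right
  simp only [h3, hα] at h2
  simpa using h2

/-- Fourier inversion on `ℤ/K`. The offset `m` is there because the basis vectors used later have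
degrees `l - r`. -/
lemma sum_gradeProj (hK : K ≠ 0) (hω : IsPrimitiveRoot ω K) (m : ℤ) (a : A) :
    ∑ l : Fin K, gradeProj α ω K ((l : ℤ) - m) a = a := by
  have hne : ω ≠ 0 := hω.ne_zero hK
  have hKc : (K : ℂ) ≠ 0 := by exact_mod_cast hK
  simp only [gradeProj_apply]
  rw [← Finset.smul_sum, Finset.sum_comm]
  have h1 : ∀ k ∈ Finset.range K, ∑ l : Fin K, ω ^ (-(((l : ℤ) - m) * k)) • α^[k] a =
      if k = 0 then (K : ℂ) • a else 0 := fun k hk => by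
    rw [← Finset.sum_smul]
    have h2 : ∀ l : Fin K, ω ^ (-(((l : ℤ) - m) * k)) = ω ^ (m * k) * ω ^ (-(k : ℤ) * (l : ℕ)) :=
      fun l => by rw [← zpow_add₀ hne]; ring_nf
    simp only [h2]
    rw [← Finset.mul_sum, Fin.sum_univ_eq_sum_range (fun l : ℕ => ω ^ (-(k : ℤ) * (l : ℕ))) K,
      sum_zpow_range hω]
    by_cases hk0 : k = 0
    · simp [hk0]
    · have : ¬ (K : ℤ) ∣ -(k : ℤ) := by
        rw [Int.dvd_neg, Int.natCast_dvd_natCast]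
        exact fun h => hk0 (Nat.eq_zero_of_dvd_of_lt h (Finset.mem_range.1 hk))
      simp [this, hk0]
  rw [Finset.sum_congr rfl h1, Finset.sum_ite_eq' (Finset.range K) 0]
  simp [Nat.pos_of_ne_zero hK, smul_smul, hKc]

/-- Only the component of `x` whose degree cancels that of `y` can contribute to degree zero. -/
lemma gradeProj_zero_mul_right {n : ℤ} {x y : A} (hy : y ∈ grade α ω n) :
    gradeProj α ω K 0 (x * y) = gradeProj α ω K (-n) x * y := by
  rw [gradeProj_apply, gradeProj_apply, smul_mul_assoc, Finset.sum_mul]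
  congr 1
  refine Finset.sum_congr rfl fun k _ => ?_
  rw [show α^[k] (x * y) = α^[k] x * α^[k] y from Function.Semiconj₂.iterate (map_mul α) k x y,
    iterate_of_mem_grade hy]
  simp

lemma gradeProj_zero_mul_left {n : ℤ} {x y : A} (hx : x ∈ grade α ω (-n)) :
    gradeProj α ω K 0 (x * y) = x * gradeProj α ω K n y := by
  rw [gradeProj_apply, gradeProj_apply, mul_smul_comm, Finset.mul_sum]
  congr 1
  refine Finset.sum_congr rfl fun k _ => ?_
  rw [show α^[k] (x * y) = α^[k] x * α^[k] y from Function.Semiconj₂.iterate (map_mul α) k x y,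
    iterate_of_mem_grade hx]
  simp

lemma gradeProj_zero_star (a : A) :
    gradeProj α ω K 0 (star a) = star (gradeProj α ω K 0 a) := by
  rw [gradeProj_apply, gradeProj_apply, star_smul, star_sum]
  congr 1
  · simp
  · refine Finset.sum_congr rfl fun k _ => ?_
    rw [show α^[k] (star a) = star (α^[k] a) from
      Function.Commute.iterate_left (f := α) (g := star) (map_star α) k a]
    simp

lemma continuous_gradeProj (n : ℤ) : Continuous (gradeProj α ω K n) := by
  have hα : Continuous α := (StarAlgEquiv.isometry α).continuous
  have : (gradeProj α ω K n : A → A) = fun a =>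
      (K : ℂ)⁻¹ • ∑ k ∈ Finset.range K, ω ^ (-(n * k)) • (α^[k] a) :=
    funext fun a => gradeProj_apply n a
  rw [this]
  exact continuous_const.smul (continuous_finsetSum _ fun k _ => (hα.iterate k).const_smul _)

end Grading

/-! ### Normal forms of words, in terms of products of subspaces. -/

section SubmodulePowers

variable {R A : Type*} [CommSemiring R] [Semiring A] [Algebra R A]

/-- The inclusion is nested in the middle `n` times. This permits inserting a block `U^n V^n`
anywhere in a product. -/
lemma le_mul_pow_mul_pow {U V : Submodule R A} (h : (1 : Submodule R A) ≤ U * V) (n : ℕ) :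
    (1 : Submodule R A) ≤ U ^ n * V ^ n := by
  induction n with
  | zero => simp
  | succ n ih =>
    calc (1 : Submodule R A) ≤ U ^ n * V ^ n := ih
      _ = U ^ n * 1 * V ^ n := by rw [mul_one]
      _ ≤ U ^ n * (U * V) * V ^ n := by gcongr
      _ = U ^ (n + 1) * V ^ (n + 1) := by rw [pow_succ U, pow_succ' V]; simp only [mul_assoc]

lemma mul_comm_of_forall {U V : Submodule R A} (h : ∀ x ∈ U, ∀ y ∈ V, x * y = y * x) :
    U * V = V * U :=
  le_antisymm
    (Submodule.mul_le.2 fun x hx y hy => by rw [h x hx y hy]; exact Submodule.mul_mem_mul hy hx)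
    (Submodule.mul_le.2 fun x hx y hy => by rw [← h y hy x hx]; exact Submodule.mul_mem_mul hy hx)

/-- If `V ^ K` commutes with `U ^ K`, then any product of elements of `U` and `V` can be put in
the normal form `U ^ n * V ^ m`. -/
lemma mul_normalForm_le {U V : Submodule R A} {K : ℕ} (hK : K ≠ 0)
    (hUV : (1 : Submodule R A) ≤ U * V) (hVU : (1 : Submodule R A) ≤ V * U)
    (hcomm : U ^ K * V ^ K = V ^ K * U ^ K) (n m : ℕ) :
    V * (U ^ n * V ^ m) ≤ ⨆ p : ℕ × ℕ, U ^ p.1 * V ^ p.2 := by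
  obtain ⟨k, rfl⟩ := Nat.exists_eq_succ_of_ne_zero hK
  simp only [Nat.succ_eq_add_one] at *
  cases n with
  | zero =>
    refine le_trans (le_of_eq ?_) (le_iSup (fun p : ℕ × ℕ => U ^ p.1 * V ^ p.2) (0, m + 1))
    simp [pow_succ']
  | succ n =>
    have hl : n + n * k = (k + 1) * n := by ring
    -- Pads `U^n` to a power of `U^K`, with `K = k + 1`, so that `V^K` can cross it.
    have hpow : U ^ n ≤ (U ^ (k + 1)) ^ n * V ^ (n * k) := by
      calc U ^ n = U ^ n * 1 := by rw [mul_one]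
        _ ≤ U ^ n * (U ^ (n * k) * V ^ (n * k)) := by gcongr; exact le_mul_pow_mul_pow hUV _
        _ = _ := by rw [← mul_assoc, ← pow_add, hl, pow_mul]
    have hc : V ^ (k + 1) * (U ^ (k + 1)) ^ n = (U ^ (k + 1)) ^ n * V ^ (k + 1) :=
      (Commute.pow_right (show Commute (V ^ (k + 1)) (U ^ (k + 1)) from hcomm.symm) n)
    -- The unit between `V` and `U` is replaced by `V^k U^k`, which completes both neighbours to
    -- `K`-th powers.
    calc V * (U ^ (n + 1) * V ^ m) = V * 1 * U * U ^ n * V ^ m := by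
          rw [pow_succ']; simp only [mul_assoc, one_mul]
      _ ≤ V * (V ^ k * U ^ k) * U * ((U ^ (k + 1)) ^ n * V ^ (n * k)) * V ^ m := by
          gcongr; exact le_mul_pow_mul_pow hVU _
      _ = (V ^ (k + 1) * U ^ (k + 1)) * ((U ^ (k + 1)) ^ n * V ^ (n * k)) * V ^ m := by
          rw [pow_succ' V, pow_succ U]; simp only [mul_assoc]
      _ = U ^ (k + 1) * (V ^ (k + 1) * (U ^ (k + 1)) ^ n) * V ^ (n * k) * V ^ m := by
          rw [← hcomm]; simp only [mul_assoc]
      _ = U ^ ((k + 1) + (k + 1) * n) * V ^ ((k + 1) + n * k + m) := by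
          rw [hc, pow_add U (k + 1) ((k + 1) * n), pow_mul U (k + 1) n, pow_add V _ m,
            pow_add V (k + 1) (n * k)]
          simp only [mul_assoc]
      _ ≤ _ := le_iSup (fun p : ℕ × ℕ => U ^ p.1 * V ^ p.2) (_, _)

/-- Inserting `U^l V^l` in the middle makes both exponents multiples of `K` at once: `K ∣ n + l` and
`K ∣ n - m` force `K ∣ l + m`. -/
lemma normalForm_le_of_dvd {U V : Submodule R A} {K : ℕ} (hK : K ≠ 0)
    (hUV : (1 : Submodule R A) ≤ U * V) {D : Subalgebra R A}
    (hUD : U ^ K ≤ Subalgebra.toSubmodule D) (hVD : V ^ K ≤ Subalgebra.toSubmodule D)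
    {n m : ℕ} (h : (K : ℤ) ∣ (n : ℤ) - m) : U ^ n * V ^ m ≤ Subalgebra.toSubmodule D := by
  have hpow : ∀ {W : Submodule R A}, W ^ K ≤ Subalgebra.toSubmodule D → ∀ j : ℕ,
      W ^ (K * j) ≤ Subalgebra.toSubmodule D := by
    intro W hW j
    rw [pow_mul]
    induction j with
    | zero => rw [pow_zero]; exact Submodule.one_le.2 D.one_mem
    | succ j ih =>
      rw [pow_succ]
      exact Submodule.mul_le.2 fun x hx y hy => D.mul_mem (ih hx) (hW hy)
  -- With `l = n (K - 1)` one has `n + l = K n`.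
  obtain ⟨l, hl⟩ : ∃ l : ℕ, K ∣ n + l := ⟨n * (K - 1), by
    obtain ⟨k, rfl⟩ := Nat.exists_eq_succ_of_ne_zero hK
    exact ⟨n, by simp; ring⟩⟩
  have hl' : K ∣ l + m := by
    have h1 : (K : ℤ) ∣ (n + l : ℕ) := Int.natCast_dvd_natCast.2 hl
    have h2 := dvd_sub h1 h
    rw [← Int.natCast_dvd_natCast]
    have h3 : ((l + m : ℕ) : ℤ) = ((n + l : ℕ) : ℤ) - ((n : ℤ) - m) := by push_cast; ring
    rwa [h3]
  obtain ⟨i, hi⟩ := hl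
  obtain ⟨j, hj⟩ := hl'
  calc U ^ n * V ^ m = U ^ n * 1 * V ^ m := by rw [mul_one]
    _ ≤ U ^ n * (U ^ l * V ^ l) * V ^ m := by gcongr; exact le_mul_pow_mul_pow hUV _
    _ = U ^ (K * i) * V ^ (K * j) := by rw [← hi, ← hj, pow_add, pow_add]; simp only [mul_assoc]
    _ ≤ _ := Submodule.mul_le.2 fun x hx y hy => D.mul_mem (hpow hUD i hx) (hpow hVD j hy)

end SubmodulePowers

/-! ### Commutativity of the degree-zero part of `C(G)`. -/

namespace CompactMatrixQuantumGroup

variable {N : ℕ} {A : Type*} [CStarAlgebra A] (G : CompactMatrixQuantumGroup N A)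

lemma denseRange_coordAlg : DenseRange (Subtype.val : coordAlg G.u → A) := by
  intro a
  rw [Subtype.range_coe]
  have h : a ∈ (coordAlg G.u).topologicalClosure := by rw [G.dense_coord]; trivial
  exact h

variable {G} in
/-- A closed property holds everywhere if it is stable under the `*`-algebra operations and holds
for the coordinates. -/
lemma closed_induction {p : A → Prop} (hp : IsClosed {a | p a})
    (coord : ∀ i j, p (G.u i j)) (algebraMap : ∀ c : ℂ, p (algebraMap ℂ A c))
    (add : ∀ a b, p a → p b → p (a + b)) (mul : ∀ a b, p a → p b → p (a * b))
    (star : ∀ a, p a → p (star a)) (a : A) : p a := by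
  refine G.denseRange_coordAlg.induction_on (p := p) a hp fun x => ?_
  refine StarAlgebra.adjoin_induction (p := fun x _ => p x) ?_ algebraMap
    (fun x y _ _ => add x y) (fun x y _ _ => mul x y) (fun x _ => star x) x.2
  rintro _ ⟨i, j, rfl⟩
  exact coord i j

lemma sum_star_mul (i j : Fin N) :
    ∑ k, star (G.u k i) * G.u k j = if i = j then 1 else 0 := by
  have h := congrFun (congrFun (Unitary.mem_iff.1 G.unitary_u).1 i) j
  simpa [Matrix.mul_apply, Matrix.one_apply, Matrix.star_apply] using h

lemma sum_mul_star (i j : Fin N) :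
    ∑ k, G.u i k * star (G.u j k) = if i = j then 1 else 0 := by
  have h := congrFun (congrFun (Unitary.mem_iff.1 G.unitary_u).2 i) j
  simpa [Matrix.mul_apply, Matrix.one_apply, Matrix.star_apply] using h

/-- The linear span of the coordinates. -/
def coordSpan : Submodule ℂ A := Submodule.span ℂ (Set.range fun p : Fin N × Fin N => G.u p.1 p.2)

/-- The linear span of the adjoints of the coordinates. -/
def starCoordSpan : Submodule ℂ A :=
  Submodule.span ℂ (Set.range fun p : Fin N × Fin N => star (G.u p.1 p.2))

lemma u_mem_coordSpan (i j : Fin N) : G.u i j ∈ G.coordSpan :=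
  Submodule.subset_span ⟨(i, j), rfl⟩

lemma star_u_mem_starCoordSpan (i j : Fin N) : star (G.u i j) ∈ G.starCoordSpan :=
  Submodule.subset_span ⟨(i, j), rfl⟩

lemma one_le_coordSpan_mul (i : Fin N) :
    (1 : Submodule ℂ A) ≤ G.coordSpan * G.starCoordSpan := by
  have h := G.sum_mul_star i i
  rw [if_pos rfl] at h
  rw [Submodule.one_le, ← h]
  exact Submodule.sum_mem _ fun k _ =>
    Submodule.mul_mem_mul (G.u_mem_coordSpan _ _) (G.star_u_mem_starCoordSpan _ _)

lemma one_le_starCoordSpan_mul (i : Fin N) :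
    (1 : Submodule ℂ A) ≤ G.starCoordSpan * G.coordSpan := by
  have h := G.sum_star_mul i i
  rw [if_pos rfl] at h
  rw [Submodule.one_le, ← h]
  exact Submodule.sum_mem _ fun k _ =>
    Submodule.mul_mem_mul (G.star_u_mem_starCoordSpan _ _) (G.u_mem_coordSpan _ _)

/-- The values of the words of length `K` and of degree a multiple of `K`. -/
def words (K : ℕ) : Set A := {x | ∃ w : Fin K → Bool × Fin N × Fin N,
  (K : ℤ) ∣ wordDegree w ∧ G.wordVal w = x}

lemma coordSpan_pow_le (K : ℕ) :
    G.coordSpan ^ K ≤ Subalgebra.toSubmodule (Algebra.adjoin ℂ (G.words K)) := by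
  rw [coordSpan, Submodule.span_pow, Submodule.span_le]
  intro x hx
  obtain ⟨f, rfl⟩ := Set.mem_pow.1 hx
  have hf : ∀ t, ∃ p : Fin N × Fin N, G.u p.1 p.2 = (f t : A) := fun t => (f t).2
  choose p hp using hf
  refine Algebra.subset_adjoin ⟨fun t => (false, p t), ?_, ?_⟩
  · simp [wordDegree]
  · simp [wordVal, letter, hp]

lemma starCoordSpan_pow_le (K : ℕ) :
    G.starCoordSpan ^ K ≤ Subalgebra.toSubmodule (Algebra.adjoin ℂ (G.words K)) := by
  rw [starCoordSpan, Submodule.span_pow, Submodule.span_le]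
  intro x hx
  obtain ⟨f, rfl⟩ := Set.mem_pow.1 hx
  have hf : ∀ t, ∃ p : Fin N × Fin N, star (G.u p.1 p.2) = (f t : A) := fun t => (f t).2
  choose p hp using hf
  refine Algebra.subset_adjoin ⟨fun t => (true, p t), ?_, ?_⟩
  · simp [wordDegree]
  · simp [wordVal, letter, hp]

variable {G} {K : ℕ}

lemma commute_of_mem_adjoin_words (hG : G.IsArithmeticHalfLiberated K) {x y : A}
    (hx : x ∈ Algebra.adjoin ℂ (G.words K)) (hy : y ∈ Algebra.adjoin ℂ (G.words K)) :
    x * y = y * x := by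
  have := Algebra.isMulCommutative_adjoin ℂ (s := G.words K) (by
    rintro _ ⟨v, hv, rfl⟩ _ ⟨w, hw, rfl⟩
    exact hG.2 v w hv hw)
  exact congrArg Subtype.val
    (this.is_comm.comm (⟨x, hx⟩ : Algebra.adjoin ℂ (G.words K)) ⟨y, hy⟩)

/-- The span of the normal forms contains `1` and is stable under left multiplication by the
coordinates and their adjoints, hence by the whole `*`-algebra they generate. -/
lemma coordAlg_le_normalForm (hK : K ≠ 0) (hG : G.IsArithmeticHalfLiberated K) (i : Fin N) {x : A}
    (hx : x ∈ coordAlg G.u) :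
    x ∈ ⨆ p : ℕ × ℕ, G.coordSpan ^ p.1 * G.starCoordSpan ^ p.2 := by
  set U := G.coordSpan
  set V := G.starCoordSpan
  set Q := ⨆ p : ℕ × ℕ, U ^ p.1 * V ^ p.2
  have hcomm : U ^ K * V ^ K = V ^ K * U ^ K := mul_comm_of_forall fun x hx y hy =>
    commute_of_mem_adjoin_words hG (G.coordSpan_pow_le K hx) (G.starCoordSpan_pow_le K hy)
  have hU : U * Q ≤ Q := by
    rw [Submodule.mul_iSup]
    refine iSup_le fun p => ?_
    rw [← mul_assoc, ← pow_succ']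
    exact le_iSup (fun p : ℕ × ℕ => U ^ p.1 * V ^ p.2) (p.1 + 1, p.2)
  have hV : V * Q ≤ Q := by
    rw [Submodule.mul_iSup]
    exact iSup_le fun p => mul_normalForm_le hK (G.one_le_coordSpan_mul i)
      (G.one_le_starCoordSpan_mul i) hcomm _ _
  have h1 : (1 : A) ∈ Q := by
    refine (le_iSup (fun p : ℕ × ℕ => U ^ p.1 * V ^ p.2) (0, 0)) ?_
    simp only [pow_zero, mul_one]
    exact Submodule.one_le.1 le_rfl
  have key : ∀ x ∈ coordAlg G.u, (∀ q ∈ Q, x * q ∈ Q) ∧ ∀ q ∈ Q, star x * q ∈ Q := by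
    intro x hx
    refine StarAlgebra.adjoin_induction
      (p := fun x _ => (∀ q ∈ Q, x * q ∈ Q) ∧ ∀ q ∈ Q, star x * q ∈ Q) ?_ ?_ ?_ ?_ ?_ hx
    · rintro _ ⟨i, j, rfl⟩
      exact ⟨fun q hq => hU (Submodule.mul_mem_mul (G.u_mem_coordSpan _ _) hq),
        fun q hq => hV (Submodule.mul_mem_mul (G.star_u_mem_starCoordSpan _ _) hq)⟩
    · intro c
      refine ⟨fun q hq => ?_, fun q hq => ?_⟩
      · rw [← Algebra.smul_def]; exact Q.smul_mem _ hq
      · rw [← algebraMap_star_comm, ← Algebra.smul_def]; exact Q.smul_mem _ hq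
    · intro x y _ _ hx hy
      refine ⟨fun q hq => ?_, fun q hq => ?_⟩
      · rw [add_mul]; exact Q.add_mem (hx.1 q hq) (hy.1 q hq)
      · rw [star_add, add_mul]; exact Q.add_mem (hx.2 q hq) (hy.2 q hq)
    · intro x y _ _ hx hy
      refine ⟨fun q hq => ?_, fun q hq => ?_⟩
      · rw [mul_assoc]; exact hx.1 _ (hy.1 q hq)
      · rw [star_mul, mul_assoc]; exact hy.2 _ (hx.2 q hq)
    · intro x _ hx
      exact ⟨hx.2, by simpa using hx.1⟩
  simpa using (key x hx).1 1 h1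

variable {α : A ≃⋆ₐ[ℂ] A} {ω : ℂ}

lemma iterate_eq_self (hω : IsPrimitiveRoot ω K) (hα : ∀ i j, α (G.u i j) = ω • G.u i j) (a : A) :
    α^[K] a = a := by
  have hc : Continuous (α^[K]) := (StarAlgEquiv.isometry α).continuous.iterate K
  have hsc : ∀ c : ℂ, α^[K] (algebraMap ℂ A c) = algebraMap ℂ A c := fun c =>
    Function.iterate_fixed (AlgHomClass.commutes α c) K
  have hadd : ∀ a b, α^[K] (a + b) = α^[K] a + α^[K] b :=
    fun a b => Function.Semiconj₂.iterate (map_add α) K a b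
  have hmul : ∀ a b, α^[K] (a * b) = α^[K] a * α^[K] b :=
    fun a b => Function.Semiconj₂.iterate (map_mul α) K a b
  have hstar : ∀ a, α^[K] (star a) = star (α^[K] a) :=
    fun a => Function.Commute.iterate_left (f := α) (g := star) (map_star α) K a
  refine closed_induction (G := G) (p := fun a => α^[K] a = a)
    (isClosed_eq hc continuous_id) (fun i j => ?_) hsc
    (fun a b ha hb => by rw [hadd, ha, hb]) (fun a b ha hb => by rw [hmul, ha, hb])
    (fun a ha => by rw [hstar, ha]) a
  have h1 : G.u i j ∈ grade α ω 1 := by simpa [mem_grade] using hα i j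
  rw [iterate_of_mem_grade h1, one_mul, zpow_natCast, hω.pow_eq_one, one_smul]

lemma pow_le_grade (hω : ω ≠ 0) {W : Submodule ℂ A} {d : ℤ} (hW : W ≤ grade α ω d) (n : ℕ) :
    W ^ n ≤ grade α ω (n * d) := by
  induction n with
  | zero => simpa using Submodule.one_le.2 (one_mem_grade (α := α) (ω := ω))
  | succ n ih =>
    rw [pow_succ]
    refine Submodule.mul_le.2 fun x hx y hy => ?_
    have := mul_mem_grade hω (ih hx) (hW hy)
    convert this using 2
    push_cast; ring

/-- A normal form `U^n V^m` is homogeneous of degree `n - m`, so the projection either kills it or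
fixes it. In the second case `K ∣ n - m`, and it splits into words of length `K`. -/
lemma gradeProj_mem_adjoin_words (hK : K ≠ 0) (hG : G.IsArithmeticHalfLiberated K) (i : Fin N)
    (hω : IsPrimitiveRoot ω K) (hα : ∀ i j, α (G.u i j) = ω • G.u i j) {x : A}
    (hx : x ∈ coordAlg G.u) :
    gradeProj α ω K 0 x ∈ Algebra.adjoin ℂ (G.words K) := by
  have hne := hω.ne_zero hK
  have hu : ∀ i j, G.u i j ∈ grade α ω 1 := fun i j => by simpa [mem_grade] using hα i j
  have hU : G.coordSpan ≤ grade α ω 1 := Submodule.span_le.2 (by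
    rintro _ ⟨p, rfl⟩; exact hu _ _)
  have hV : G.starCoordSpan ≤ grade α ω (-1) := Submodule.span_le.2 (by
    rintro _ ⟨p, rfl⟩; exact star_mem_grade (hω.norm'_eq_one hK) (hu _ _))
  suffices h : (⨆ p : ℕ × ℕ, G.coordSpan ^ p.1 * G.starCoordSpan ^ p.2) ≤
      (Subalgebra.toSubmodule (Algebra.adjoin ℂ (G.words K))).comap (gradeProj α ω K 0) from
    h (coordAlg_le_normalForm hK hG i hx)
  refine iSup_le fun p y hy => ?_
  have hgr : G.coordSpan ^ p.1 * G.starCoordSpan ^ p.2 ≤ grade α ω ((p.1 : ℤ) - p.2) :=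
    Submodule.mul_le.2 fun a ha b hb => by
      have := mul_mem_grade hne (pow_le_grade hne hU _ ha) (pow_le_grade hne hV _ hb)
      convert this using 2
      ring
  rw [Submodule.mem_comap, gradeProj_of_mem_grade hK hω (hgr hy), sub_zero]
  split_ifs with h
  · exact normalForm_le_of_dvd hK (G.one_le_coordSpan_mul i) (G.coordSpan_pow_le K)
      (G.starCoordSpan_pow_le K) h hy
  · exact Submodule.zero_mem _

/-- The fixed point algebra of the `ℤ_K`-action is commutative. -/
theorem commute_of_mem_grade_zero (hK : K ≠ 0) (hG : G.IsArithmeticHalfLiberated K) (i : Fin N)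
    (hω : IsPrimitiveRoot ω K) (hα : ∀ i j, α (G.u i j) = ω • G.u i j) {a b : A}
    (ha : a ∈ grade α ω 0) (hb : b ∈ grade α ω 0) : a * b = b * a := by
  have hc := continuous_gradeProj (α := α) (ω := ω) (K := K) 0
  -- Phrased through the continuous projection, commutativity passes from the dense coordinate
  -- algebra to all of `A`.
  have key : ∀ a b : A, gradeProj α ω K 0 a * gradeProj α ω K 0 b =
      gradeProj α ω K 0 b * gradeProj α ω K 0 a := by
    intro a b
    refine G.denseRange_coordAlg.induction_on₂ (p := fun a b =>
      gradeProj α ω K 0 a * gradeProj α ω K 0 b = gradeProj α ω K 0 b * gradeProj α ω K 0 a)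
      ?_ (fun x y => ?_) a b
    · exact isClosed_eq ((hc.comp continuous_fst).mul (hc.comp continuous_snd))
        ((hc.comp continuous_snd).mul (hc.comp continuous_fst))
    · exact commute_of_mem_adjoin_words hG (gradeProj_mem_adjoin_words hK hG i hω hα x.2)
        (gradeProj_mem_adjoin_words hK hG i hω hα y.2)
  have h := key a b
  rw [gradeProj_of_mem_grade hK hω ha, gradeProj_of_mem_grade hK hω hb] at h
  simpa using h

end CompactMatrixQuantumGroup

/-! ### Representations on `ℂ^K` induced from characters of the degree-zero part. -/

lemma fin_eq_of_dvd_sub {K : ℕ} {k l : Fin K} (h : (K : ℤ) ∣ (l : ℤ) - k) : k = l := by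
  have h1 : ((l : ℤ) - k) = 0 := Int.eq_zero_of_abs_lt_dvd h (by rw [abs_lt]; omega)
  exact Fin.ext (by omega)

lemma dvd_finRotate_sub {K : ℕ} (l : Fin K) :
    (K : ℤ) ∣ (finRotate K l : ℤ) - (1 + (l : ℤ)) := by
  cases K with
  | zero => exact l.elim0
  | succ n =>
    rw [coe_finRotate]
    split_ifs with hl
    · subst hl; exact ⟨-1, by simp; ring⟩
    · exact ⟨0, by push_cast; ring⟩

lemma eq_finRotate_of_dvd {K : ℕ} {k l : Fin K} (h : (K : ℤ) ∣ 1 + (l : ℤ) - k) :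
    k = finRotate K l := by
  refine fin_eq_of_dvd_sub ?_
  rw [show (finRotate K l : ℤ) - (k : ℤ) =
    ((finRotate K l : ℤ) - (1 + (l : ℤ))) + (1 + (l : ℤ) - k) by ring]
  exact dvd_add (dvd_finRotate_sub l) h

section CharacterRep

variable {A : Type*} [CStarAlgebra A] {α : A ≃⋆ₐ[ℂ] A} {ω : ℂ} {K : ℕ} {θ : A →ₗ[ℂ] ℂ}

/-- The degree-`n` part of the GNS space is the line through the unit vector `c`, so `c c*` acts
there as the identity. Algebraically, `y c*` and `c c*` lie in the commutative part and can be
exchanged; the leftover factors `c* c` have `θ`-value `1`. -/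
lemma theta_mul_of_normalized (hne : ω ≠ 0) (hω : ‖ω‖ = 1)
    (hcomm : ∀ a ∈ grade α ω 0, ∀ b ∈ grade α ω 0, a * b = b * a)
    (hmul : ∀ a ∈ grade α ω 0, ∀ b ∈ grade α ω 0, θ (a * b) = θ a * θ b)
    {n : ℤ} {x y c : A} (hx : x ∈ grade α ω (-n)) (hy : y ∈ grade α ω n)
    (hc : c ∈ grade α ω n) (hcc : θ (star c * c) = 1) :
    θ (x * c) * θ (star c * y) = θ (x * y) := by
  have hc' := star_mem_grade hω hc
  have m1 : ∀ {a b : A}, a ∈ grade α ω (-n) → b ∈ grade α ω n → a * b ∈ grade α ω 0 :=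
    fun ha hb => by simpa using mul_mem_grade hne ha hb
  have m2 : ∀ {a b : A}, a ∈ grade α ω n → b ∈ grade α ω (-n) → a * b ∈ grade α ω 0 :=
    fun ha hb => by simpa using mul_mem_grade hne ha hb
  have m0 : ∀ {a b : A}, a ∈ grade α ω 0 → b ∈ grade α ω 0 → a * b ∈ grade α ω 0 :=
    fun ha hb => by simpa using mul_mem_grade hne ha hb
  have e : x * y * (star c * c) * (star c * c) = (x * c) * (star c * y) * (star c * c) := by
    have h := hcomm _ (m2 hy hc') _ (m2 hc hc')
    calc x * y * (star c * c) * (star c * c) = x * (y * star c * (c * star c)) * c := by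
          simp only [mul_assoc]
      _ = _ := by rw [h]; simp only [mul_assoc]
  have h1 := congrArg θ e
  rw [hmul _ (m0 (m1 hx hy) (m1 hc' hc)) _ (m1 hc' hc), hmul _ (m1 hx hy) _ (m1 hc' hc),
    hmul _ (m0 (m1 hx hc) (m1 hc' hy)) _ (m1 hc' hc), hmul _ (m1 hx hc) _ (m1 hc' hy), hcc] at h1
  simpa using h1.symm

/-- The representation of `A` on the module induced by a character of the fixed point algebra,
in the orthonormal basis given by elements `c l` of degree `l - r`. -/
theorem exists_rep_of_theta (hK : K ≠ 0) (hω : IsPrimitiveRoot ω K) (hα : ∀ a, α^[K] a = a)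
    (hcomm : ∀ a ∈ grade α ω 0, ∀ b ∈ grade α ω 0, a * b = b * a)
    (hmul : ∀ a ∈ grade α ω 0, ∀ b ∈ grade α ω 0, θ (a * b) = θ a * θ b)
    (hproj : ∀ a, θ (gradeProj α ω K 0 a) = θ a) (hstar : ∀ a, θ (star a) = star (θ a))
    (r : ℤ) (c : Fin K → A) (hc : ∀ l : Fin K, c l ∈ grade α ω ((l : ℤ) - r))
    (hcc : ∀ l, θ (star (c l) * c l) = 1) :
    ∃ ρ : A →⋆ₐ[ℂ] Matrix (Fin K) (Fin K) ℂ, ∀ a k l, ρ a k l = θ (star (c k) * a * c l) := by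
  have hne := hω.ne_zero hK
  have hnorm : ‖ω‖ = 1 := hω.norm'_eq_one hK
  -- Completeness of the orthonormal family `c`: the `l`-th term sees only the component of `y` of
  -- degree `l - r`, and these components sum to `y`.
  have hmulsum : ∀ x y, ∑ l, θ (x * c l) * θ (star (c l) * y) = θ (x * y) := by
    intro x y
    have h1 : ∀ l : Fin K, θ (x * c l) * θ (star (c l) * y) =
        θ (x * gradeProj α ω K ((l : ℤ) - r) y) := fun l => by
      have hl := hc l
      have hl' := star_mem_grade hnorm hl
      have hp := gradeProj_mem hK hω hα ((l : ℤ) - r) y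
      have hp' := gradeProj_mem hK hω hα (-((l : ℤ) - r)) x
      rw [← hproj (x * c l), gradeProj_zero_mul_right hl, ← hproj (star (c l) * y),
        gradeProj_zero_mul_left hl', ← hproj (x * _), gradeProj_zero_mul_right hp]
      exact theta_mul_of_normalized hne hnorm hcomm hmul hp' hp hl (hcc l)
    rw [Finset.sum_congr rfl fun l _ => h1 l, ← map_sum, ← Finset.mul_sum,
      sum_gradeProj hK hω r y]
  let L : A →ₗ[ℂ] Matrix (Fin K) (Fin K) ℂ :=
    { toFun := fun a => Matrix.of fun k l => θ (star (c k) * a * c l)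
      map_add' := fun a b => by ext k l; simp [mul_add, add_mul]
      map_smul' := fun z a => by ext k l; simp }
  have hL : ∀ a k l, L a k l = θ (star (c k) * a * c l) := fun _ _ _ => rfl
  have L1 : L 1 = 1 := by
    ext k l
    rw [hL, mul_one, Matrix.one_apply]
    split_ifs with h
    · rw [h, hcc]
    · rw [← hproj, gradeProj_of_mem_grade hK hω
        (mul_mem_grade hne (star_mem_grade hnorm (hc k)) (hc l)), if_neg, map_zero]
      intro hd
      have hd' : (K : ℤ) ∣ (l : ℤ) - k := by convert hd using 1; ring
      exact h (fin_eq_of_dvd_sub hd')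
  have Lmul : ∀ a b, L (a * b) = L a * L b := fun a b => by
    ext k m
    rw [Matrix.mul_apply]
    simp only [hL]
    rw [show star (c k) * (a * b) * c m = (star (c k) * a) * (b * c m) by simp only [mul_assoc],
      ← hmulsum]
    simp only [mul_assoc]
  have Lstar : ∀ a, L (star a) = star (L a) := fun a => by
    ext k l
    rw [Matrix.star_apply, hL, hL, ← hstar]
    simp [mul_assoc]
  exact ⟨{ AlgHom.ofLinearMap L L1 Lmul with map_star' := Lstar }, hL⟩

/-- The fixed point algebra of an automorphism. -/
def fixedAlg (α : A ≃⋆ₐ[ℂ] A) : StarSubalgebra ℂ A where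
  carrier := {a | α a = a}
  mul_mem' {a b} ha hb := by
    simp only [Set.mem_ofPred_eq] at ha hb ⊢
    rw [map_mul, ha, hb]
  add_mem' {a b} ha hb := by
    simp only [Set.mem_ofPred_eq] at ha hb ⊢
    rw [map_add, ha, hb]
  algebraMap_mem' c := AlgHomClass.commutes α c
  star_mem' {a} ha := by
    simp only [Set.mem_ofPred_eq] at ha ⊢
    rw [map_star, ha]

lemma mem_fixedAlg {a : A} : a ∈ fixedAlg α ↔ a ∈ grade α ω 0 := by
  rw [mem_grade, zpow_zero, one_smul]; rfl

lemma isClosed_fixedAlg : IsClosed (fixedAlg α : Set A) :=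
  isClosed_eq (StarAlgEquiv.isometry α).continuous continuous_id

/-- The functional obtained from a character of the fixed point algebra by averaging. -/
def averagedChar (hK : K ≠ 0) (hω : IsPrimitiveRoot ω K) (hα : ∀ a, α^[K] a = a)
    (χ : fixedAlg α →ₐ[ℂ] ℂ) : A →ₗ[ℂ] ℂ :=
  χ.toLinearMap ∘ₗ (gradeProj α ω K 0).codRestrict (Subalgebra.toSubmodule
    (fixedAlg α).toSubalgebra) fun a => mem_fixedAlg.2 (gradeProj_mem hK hω hα 0 a)

lemma averagedChar_of_mem (hK : K ≠ 0) (hω : IsPrimitiveRoot ω K) (hα : ∀ a, α^[K] a = a)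
    (χ : fixedAlg α →ₐ[ℂ] ℂ) {a : A} (ha : a ∈ fixedAlg α) :
    averagedChar hK hω hα χ a = χ ⟨a, ha⟩ := by
  change χ _ = _
  congr 1
  ext
  change gradeProj α ω K 0 a = a
  simpa using gradeProj_of_mem_grade (n := 0) hK hω (mem_fixedAlg.1 ha)

/-- As `a` itself need not be fixed by `α`, the value is not simply `|χ a|²`. Spectral permanence
places it in the spectrum of `star a * a` in `A`, which is nonnegative. -/
lemma character_nonneg (χ : fixedAlg α →ₐ[ℂ] ℂ) {a : A} (ha : star a * a ∈ fixedAlg α) :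
    0 ≤ χ ⟨star a * a, ha⟩ := by
  let := CStarAlgebra.spectralOrder A
  have := CStarAlgebra.spectralOrderedRing A
  have : IsClosed (fixedAlg α : Set A) := isClosed_fixedAlg
  rcases subsingleton_or_nontrivial (fixedAlg α) with h | h
  · have : χ 1 = 0 := by rw [Subsingleton.elim (1 : fixedAlg α) 0, map_zero]
    simp at this
  have h1 : χ ⟨star a * a, ha⟩ ∈ spectrum ℂ (star a * a) := by
    have := AlgHom.apply_mem_spectrum χ ⟨star a * a, ha⟩
    rwa [StarSubalgebra.spectrum_eq] at this
  have h2 := (IsSelfAdjoint.star_mul_self a).mem_spectrum_eq_re h1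
  rw [h2] at h1 ⊢
  have h3 := spectrum_star_mul_self_nonneg _
    ((spectrum.algebraMap_mem_iff ℂ (R := ℝ)).1 h1)
  exact_mod_cast h3

end CharacterRep

/-! ### Cyclic representations separate the degree-zero part. -/

namespace CompactMatrixQuantumGroup

variable {N K : ℕ} {A : Type*} [CStarAlgebra A] (G : CompactMatrixQuantumGroup N A)

/-- The representations of `C(G)` on `ℂ ^ K` which map the coordinates to matrices supported on
the standard cycle. -/
def IsCyclicRep (ρ : A →⋆ₐ[ℂ] Matrix (Fin K) (Fin K) ℂ) : Prop :=
  ∀ i j k l, k ≠ finRotate K l → ρ (G.u i j) k l = 0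

/-- Without coordinates `A` is the closure of the scalars, and the counit reads off the scalar. -/
lemma exists_algebraMap_eq (G : CompactMatrixQuantumGroup N A) (hN : N = 0) (a : A) :
    ∃ c : ℂ, a = algebraMap ℂ A c := by
  refine ⟨G.counit a, ?_⟩
  have hε : Continuous G.counit :=
    NonUnitalStarAlgHom.instContinuousLinearMapClassComplex.map_continuous G.counit
  refine closed_induction (G := G) (p := fun a => a = algebraMap ℂ A (G.counit a))
    (isClosed_eq continuous_id ((algebraMapCLM ℂ A).continuous.comp hε))
    (fun i => (Fin.cast hN i).elim0)
    (fun c => congrArg _ (AlgHomClass.commutes G.counit c).symm) (fun a b ha hb => ?_)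
    (fun a b ha hb => ?_) (fun a ha => ?_) a
  · rw [map_add, map_add, ← ha, ← hb]
  · rw [map_mul, map_mul, ← ha, ← hb]
  · rw [map_star, algebraMap_star_comm, ← ha]

variable {G} {α : A ≃⋆ₐ[ℂ] A} {ω : ℂ}

/-- If `d` is a unit vector, unitarity of `u` makes the squared norms of the `u_ki d` sum to `1`
over `k`. One of them is nonzero, and normalizing it gives a unit vector one degree higher. -/
lemma exists_normalized_of_theta (hω : ω ≠ 0) (hα : ∀ i j, α (G.u i j) = ω • G.u i j)
    (θ : A →ₗ[ℂ] ℂ) (h1 : θ 1 = 1) (hpos : ∀ n, ∀ a ∈ grade α ω n, 0 ≤ θ (star a * a))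
    (i : Fin N) (n : ℕ) : ∃ d ∈ grade α ω n, θ (star d * d) = 1 := by
  induction n with
  | zero => exact ⟨1, by simpa using one_mem_grade, by simpa using h1⟩
  | succ n ih =>
    obtain ⟨d, hd, hd1⟩ := ih
    have hsum : ∑ k, θ (star (G.u k i * d) * (G.u k i * d)) = 1 := by
      rw [← map_sum, ← hd1]
      congr 1
      have h2 := G.sum_star_mul i i
      rw [if_pos rfl] at h2
      calc ∑ k, star (G.u k i * d) * (G.u k i * d)
          = star d * (∑ k, star (G.u k i) * G.u k i) * d := by
            rw [Finset.mul_sum, Finset.sum_mul]; simp only [star_mul, mul_assoc]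
        _ = star d * d := by rw [h2, mul_one]
    obtain ⟨k, -, hk⟩ := Finset.exists_ne_zero_of_sum_ne_zero (hsum.trans_ne one_ne_zero)
    have hmem : G.u k i * d ∈ grade α ω ((n + 1 : ℕ) : ℤ) := by
      have hu : G.u k i ∈ grade α ω 1 := by simpa [mem_grade] using hα k i
      have := mul_mem_grade hω hu hd
      rwa [show ((n + 1 : ℕ) : ℤ) = 1 + (n : ℤ) by push_cast; ring]
    have hp := hpos _ _ hmem
    set e := G.u k i * d
    obtain ⟨t, ht⟩ : ∃ t : ℝ, θ (star e * e) = t := ⟨_, (Complex.eq_re_of_ofReal_le hp)⟩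
    rw [ht] at hk hp
    have ht0 : 0 < t := lt_of_le_of_ne (by exact_mod_cast hp) (by
      rintro rfl; simp at hk)
    refine ⟨((Real.sqrt t)⁻¹ : ℂ) • e, Submodule.smul_mem _ _ hmem, ?_⟩
    rw [star_smul, smul_mul_smul_comm, map_smul, ht]
    have hs : ((Real.sqrt t : ℝ) : ℂ) * (Real.sqrt t : ℝ) = t := by
      rw [← Complex.ofReal_mul, Real.mul_self_sqrt ht0.le]
    have hs0 : ((Real.sqrt t : ℝ) : ℂ) ≠ 0 := by
      rw [Complex.ofReal_ne_zero]; exact (Real.sqrt_pos.2 ht0).ne'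
    simp only [star_inv₀, Complex.star_def, Complex.conj_ofReal, smul_eq_mul]
    rw [← hs]
    field_simp

/-- The diagonal coefficients of the cyclic representations separate the elements of the fixed
point algebra. -/
theorem eq_zero_of_forall_isCyclicRep (hK : K ≠ 0) (hG : G.IsArithmeticHalfLiberated K)
    (hω : IsPrimitiveRoot ω K) (hα : ∀ i j, α (G.u i j) = ω • G.u i j) (r : Fin K) {a : A}
    (ha : a ∈ grade α ω 0)
    (h : ∀ ρ : A →⋆ₐ[ℂ] Matrix (Fin K) (Fin K) ℂ, G.IsCyclicRep ρ → ρ a r r = 0) : a = 0 := by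
  rcases Nat.eq_zero_or_pos N with hN | hN
  · obtain ⟨c, rfl⟩ := G.exists_algebraMap_eq hN a
    let ρ : A →⋆ₐ[ℂ] Matrix (Fin K) (Fin K) ℂ :=
      (StarAlgHom.ofId ℂ (Matrix (Fin K) (Fin K) ℂ)).comp G.counit
    have h1 := h ρ (fun i => (Fin.cast hN i).elim0)
    rw [AlgHomClass.commutes, Matrix.algebraMap_matrix_apply, if_pos rfl] at h1
    have hc : c = 0 := by simpa using h1
    rw [hc, map_zero]
  let i₀ : Fin N := ⟨0, hN⟩
  have hne := hω.ne_zero hK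
  have hnorm : ‖ω‖ = 1 := hω.norm'_eq_one hK
  have hit := iterate_eq_self (G := G) hω hα
  have hcomm : ∀ a ∈ grade α ω 0, ∀ b ∈ grade α ω 0, a * b = b * a := fun a ha b hb =>
    commute_of_mem_grade_zero hK hG i₀ hω hα ha hb
  have hcl : IsClosed (fixedAlg α : Set A) := isClosed_fixedAlg
  let _ : CommCStarAlgebra (fixedAlg α) :=
    { (inferInstance : CStarAlgebra (fixedAlg α)) with
      mul_comm := fun x y => Subtype.ext
        (hcomm _ (mem_fixedAlg.1 x.2) _ (mem_fixedAlg.1 y.2)) }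
  have haF : a ∈ fixedAlg α := mem_fixedAlg.2 ha
  suffices hz : (⟨a, haF⟩ : fixedAlg α) = 0 from congrArg Subtype.val hz
  -- It now suffices that every character `χ` of the fixed point algebra vanishes at `a`.
  refine (gelfandTransform_isometry (fixedAlg α)).injective ?_
  rw [map_zero]
  ext χ
  change χ ⟨a, haF⟩ = 0
  let χ' : fixedAlg α →ₐ[ℂ] ℂ := WeakDual.CharacterSpace.toAlgHom χ
  have hχ' : ∀ x, χ' x = χ x := fun _ => rfl
  let θ : A →ₗ[ℂ] ℂ := averagedChar hK hω hit χ'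
  have hθ : ∀ {x : A} (hx : x ∈ grade α ω 0), θ x = χ ⟨x, mem_fixedAlg.2 hx⟩ := fun hx =>
    averagedChar_of_mem hK hω hit χ' (mem_fixedAlg.2 hx)
  have hproj : ∀ x, θ (gradeProj α ω K 0 x) = θ x := fun x => by
    rw [hθ (gradeProj_mem hK hω hit 0 x)]; rfl
  have hstar : ∀ x, θ (star x) = star (θ x) := fun x => by
    have hm := gradeProj_mem hK hω hit 0 x
    have hm' : star (gradeProj α ω K 0 x) ∈ grade α ω 0 := by
      simpa using star_mem_grade hnorm hm
    rw [← hproj (star x), ← hproj x, gradeProj_zero_star, hθ hm', hθ hm]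
    exact map_star χ (⟨_, mem_fixedAlg.2 hm⟩ : fixedAlg α)
  have hmul : ∀ x ∈ grade α ω 0, ∀ y ∈ grade α ω 0, θ (x * y) = θ x * θ y :=
    fun x hx y hy => by
      have hxy : x * y ∈ grade α ω 0 := by simpa using mul_mem_grade hne hx hy
      rw [hθ hxy, hθ hx, hθ hy, ← map_mul]
      rfl
  have h1 : θ 1 = 1 := by
    rw [hθ one_mem_grade]
    exact map_one χ
  have hpos : ∀ n, ∀ x ∈ grade α ω n, 0 ≤ θ (star x * x) := fun n x hx => by
    have hm : star x * x ∈ grade α ω 0 := by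
      simpa using mul_mem_grade hne (star_mem_grade hnorm hx) hx
    rw [hθ hm]
    exact character_nonneg χ' _
  -- Requiring the `r`-th basis vector to be `1` makes the `(r, r)` coefficient of the
  -- representation equal to `χ` on degree zero.
  have hex : ∀ l : Fin K, ∃ d ∈ grade α ω ((l : ℤ) - (r : ℤ)),
      θ (star d * d) = 1 ∧ (l = r → d = 1) := fun l => by
    by_cases hl : l = r
    · subst hl
      exact ⟨1, by rw [sub_self]; exact one_mem_grade, by simpa using h1, fun _ => rfl⟩
    -- `l + (K - r)` is a natural number congruent to `l - r` modulo `K`.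
    · obtain ⟨d, hd, hd1⟩ := exists_normalized_of_theta hne hα θ h1 hpos i₀ (l + (K - r))
      refine ⟨d, ?_, hd1, fun h => absurd h hl⟩
      rwa [grade_congr hω (n := ((l + (K - r) : ℕ) : ℤ)) ⟨-1, by omega⟩]
  choose c hc hcc hcr using hex
  obtain ⟨ρ, hρ⟩ := exists_rep_of_theta hK hω hit hcomm hmul hproj hstar r c hc hcc
  have h2 := h ρ fun i j k l hkl => by
    rw [hρ, ← hproj]
    have hu : G.u i j ∈ grade α ω 1 := by simpa [mem_grade] using hα i j
    rw [gradeProj_of_mem_grade hK hω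
      (mul_mem_grade hne (mul_mem_grade hne (star_mem_grade hnorm (hc k)) hu) (hc l)), if_neg,
      map_zero]
    intro hd
    refine hkl (eq_finRotate_of_dvd ?_)
    convert hd using 1
    ring
  rw [hρ, hcr r rfl, star_one, one_mul, mul_one, hθ ha] at h2
  exact h2

end CompactMatrixQuantumGroup

/-! ### Coefficients and tensor products of matrix representations. -/

section MatrixRep

variable {K : ℕ} {A : Type*} [CStarAlgebra A]

lemma norm_rep_apply_le (ρ : A →⋆ₐ[ℂ] Matrix (Fin K) (Fin K) ℂ) (a : A) (r s : Fin K) :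
    ‖ρ a r s‖ ≤ ‖a‖ := by
  let e : Matrix (Fin K) (Fin K) ℂ ≃⋆ₐ[ℂ] CStarMatrix (Fin K) (Fin K) ℂ :=
    CStarMatrix.ofMatrixStarAlgEquiv
  let f : A →⋆ₐ[ℂ] CStarMatrix (Fin K) (Fin K) ℂ :=
    (e : Matrix (Fin K) (Fin K) ℂ →⋆ₐ[ℂ] CStarMatrix (Fin K) (Fin K) ℂ).comp ρ
  exact (CStarMatrix.norm_entry_le_norm (M := f a)).trans (NonUnitalStarAlgHom.norm_apply_le f a)

/-- The coefficients of a matrix representation, as continuous linear functionals. -/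
def coeffCLM (ρ : A →⋆ₐ[ℂ] Matrix (Fin K) (Fin K) ℂ) (r s : Fin K) : A →L[ℂ] ℂ :=
  LinearMap.mkContinuous
    { toFun := fun a => ρ a r s
      map_add' := fun a b => by rw [map_add, Matrix.add_apply]
      map_smul' := fun c a => by rw [map_smul, Matrix.smul_apply]; rfl } 1
    fun a => by rw [one_mul]; exact norm_rep_apply_le ρ a r s

@[simp] lemma coeffCLM_apply (ρ : A →⋆ₐ[ℂ] Matrix (Fin K) (Fin K) ℂ) (r s : Fin K) (a : A) :
    coeffCLM ρ r s a = ρ a r s := rfl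

lemma rep_star_mul_apply (ρ : A →⋆ₐ[ℂ] Matrix (Fin K) (Fin K) ℂ) (a : A) (s : Fin K) :
    ρ (star a * a) s s = ((∑ r, ‖ρ a r s‖ ^ 2 : ℝ) : ℂ) := by
  rw [map_mul, map_star, Matrix.mul_apply, Complex.ofReal_sum]
  refine Finset.sum_congr rfl fun r _ => ?_
  rw [Matrix.star_apply, Complex.star_def, Complex.conj_mul', Complex.ofReal_pow]

lemma isState_coeffCLM (ρ : A →⋆ₐ[ℂ] Matrix (Fin K) (Fin K) ℂ) (s : Fin K) :
    IsState (coeffCLM ρ s s) := by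
  refine ⟨by simp, fun a => ?_⟩
  rw [coeffCLM_apply, rep_star_mul_apply]
  exact_mod_cast Finset.sum_nonneg fun r _ => by positivity

@[simp] lemma prodFunctional_tmul (φ ψ : A →L[ℂ] ℂ) (a b : A) :
    prodFunctional φ ψ (a ⊗ₜ[ℂ] b) = φ a * ψ b := rfl

open scoped Kronecker in
/-- The tensor product of two matrix representations. -/
def tensorRep (ρ ρ' : A →⋆ₐ[ℂ] Matrix (Fin K) (Fin K) ℂ) :
    A ⊗[ℂ] A →ₐ[ℂ] Matrix (Fin K × Fin K) (Fin K × Fin K) ℂ :=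
  Algebra.TensorProduct.algHomOfLinearMapTensorProduct
    { toFun := fun t => Matrix.of fun x y =>
        prodFunctional (coeffCLM ρ x.1 y.1) (coeffCLM ρ' x.2 y.2) t
      map_add' := fun t t' => by ext; simp
      map_smul' := fun c t => by ext; simp }
    (fun a₁ a₂ b₁ b₂ => by
      have h : ∀ a b, (Matrix.of fun x y => prodFunctional (coeffCLM ρ x.1 y.1)
          (coeffCLM ρ' x.2 y.2) (a ⊗ₜ[ℂ] b)) = ρ a ⊗ₖ ρ' b := fun a b => rfl
      change Matrix.of _ = Matrix.of _ * Matrix.of _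
      rw [h, h, h, map_mul, map_mul, Matrix.mul_kronecker_mul])
    (by
      change Matrix.of _ = 1
      have h : (Matrix.of fun x y => prodFunctional (coeffCLM ρ x.1 y.1)
          (coeffCLM ρ' x.2 y.2) (1 ⊗ₜ[ℂ] 1)) = ρ 1 ⊗ₖ ρ' 1 := rfl
      rw [h, map_one, map_one, Matrix.one_kronecker_one])

lemma tensorRep_apply (ρ ρ' : A →⋆ₐ[ℂ] Matrix (Fin K) (Fin K) ℂ) (t : A ⊗[ℂ] A)
    (x y : Fin K × Fin K) : tensorRep ρ ρ' t x y =
      prodFunctional (coeffCLM ρ x.1 y.1) (coeffCLM ρ' x.2 y.2) t := rfl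

lemma tensorRep_star (ρ ρ' : A →⋆ₐ[ℂ] Matrix (Fin K) (Fin K) ℂ) (t : A ⊗[ℂ] A) :
    tensorRep ρ ρ' (star t) = star (tensorRep ρ ρ' t) := by
  ext x y
  induction t with
  | zero => simp
  | add t t' h h' =>
    rw [star_add, map_add, map_add, star_add, Matrix.add_apply, Matrix.add_apply, h, h']
  | tmul a b =>
    rw [TensorProduct.star_tmul, Matrix.star_apply, tensorRep_apply, tensorRep_apply]
    simp [map_star, Matrix.star_apply]

/-- The compression of a representation on `ℂ ^ K ⊗ ℂ ^ K` to an invariant diagonal. -/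
def diagRep {B : Type*} [Semiring B] [Algebra ℂ B] [StarRing B]
    (D : B →⋆ₐ[ℂ] Matrix (Fin K × Fin K) (Fin K × Fin K) ℂ)
    (hD : ∀ x r p s, r ≠ p → D x (r, p) (s, s) = 0) : B →⋆ₐ[ℂ] Matrix (Fin K) (Fin K) ℂ where
  toFun x := Matrix.of fun r s => D x (r, r) (s, s)
  map_one' := by ext r s; simp [Matrix.one_apply]
  map_mul' x y := by
    ext r s
    simp only [map_mul, Matrix.of_apply, Matrix.mul_apply, Fintype.sum_prod_type]
    refine Finset.sum_congr rfl fun q _ => ?_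
    rw [Finset.sum_eq_single q]
    · intro p _ hp
      rw [hD y q p s hp.symm, mul_zero]
    · simp
  map_zero' := by ext; simp
  map_add' x y := by ext; simp
  commutes' c := by
    ext r s
    rw [Matrix.of_apply, AlgHomClass.commutes]
    simp [Matrix.algebraMap_matrix_apply]
  map_star' x := by ext; simp [map_star, Matrix.star_apply]

end MatrixRep

/-! ### Points of `U_N^K` that define representations, and the group operations on them. -/

namespace CompactMatrixQuantumGroup

variable {N K : ℕ} {A : Type*} [CStarAlgebra A] (G : CompactMatrixQuantumGroup N A)

/-- The representation `ρ` of `C(G)` is the one given by the point `g` of `U_N ^ K`. -/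
def IsModel (g : UnitaryPow N K) (ρ : A →⋆ₐ[ℂ] Matrix (Fin K) (Fin K) ℂ) : Prop :=
  ∀ i j, ρ (G.u i j) = cycleMatrix fun r => (g r : Matrix (Fin N) (Fin N) ℂ) i j

variable {G}

lemma coordAlg_induction {p : coordAlg G.u → Prop} (coord : ∀ i j, p (coord G.u i j))
    (algebraMap : ∀ c : ℂ, p (algebraMap ℂ (coordAlg G.u) c))
    (add : ∀ a b, p a → p b → p (a + b)) (mul : ∀ a b, p a → p b → p (a * b))
    (star : ∀ a, p a → p (star a)) (x : coordAlg G.u) : p x :=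
  StarAlgebra.adjoin_induction_subtype x (by rintro _ ⟨i, j, rfl⟩; exact coord i j)
    algebraMap add mul star

lemma IsModel.ext {g : UnitaryPow N K} {ρ ρ' : A →⋆ₐ[ℂ] Matrix (Fin K) (Fin K) ℂ}
    (h : G.IsModel g ρ) (h' : G.IsModel g ρ') : ρ = ρ' := by
  ext a r s
  refine congrFun (congrFun (closed_induction (G := G) (p := fun a => ρ a = ρ' a) ?_ ?_ ?_ ?_ ?_ ?_
    a) r) s
  · have : {a | ρ a = ρ' a} = ⋂ r, ⋂ s, {a | coeffCLM ρ r s a = coeffCLM ρ' r s a} := by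
      ext a
      simp [← Matrix.ext_iff]
    rw [this]
    exact isClosed_iInter fun r => isClosed_iInter fun s =>
      isClosed_eq (coeffCLM ρ r s).continuous (coeffCLM ρ' r s).continuous
  · intro i j; rw [h i j, h' i j]
  · intro c; rw [AlgHomClass.commutes, AlgHomClass.commutes]
  · intro a b ha hb; rw [map_add, map_add, ha, hb]
  · intro a b ha hb; rw [map_mul, map_mul, ha, hb]
  · intro a ha; rw [map_star, map_star, ha]

/-- Row `r` of each `ρ(u_ij)` has a single possibly nonzero entry, so the `(r, r)` entry of `ρ`
applied to `u u* = 1` is the unitarity of the `r`-th component. -/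
lemma IsCyclicRep.exists_isModel {ρ : A →⋆ₐ[ℂ] Matrix (Fin K) (Fin K) ℂ} (h : G.IsCyclicRep ρ) :
    ∃ g : UnitaryPow N K, G.IsModel g ρ := by
  let m : Fin K → Matrix (Fin N) (Fin N) ℂ := fun r =>
    Matrix.of fun i j => ρ (G.u i j) r ((finRotate K).symm r)
  have hm : ∀ r, m r ∈ Matrix.unitaryGroup (Fin N) ℂ := fun r => by
    rw [Matrix.mem_unitaryGroup_iff]
    ext i j
    have h1 := congrFun (congrFun (congrArg ρ (G.sum_mul_star i j)) r) r
    rw [map_sum, Matrix.sum_apply] at h1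
    rw [Matrix.mul_apply]
    calc ∑ k, m r i k * star (m r) k j = ∑ k, ρ (G.u i k * star (G.u j k)) r r := by
          refine Finset.sum_congr rfl fun k _ => ?_
          rw [map_mul, map_star, Matrix.mul_apply, Finset.sum_eq_single ((finRotate K).symm r)]
          · rfl
          · intro s _ hs
            rw [h i k r s (by rintro rfl; simp [-finRotate_apply] at hs), zero_mul]
          · simp
      _ = _ := by
          rw [h1, Matrix.one_apply]
          split_ifs <;> simp
  refine ⟨fun r => ⟨m r, hm r⟩, fun i j => ?_⟩
  ext r s
  rw [cycleMatrix]
  split_ifs with hrs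
  · subst hrs
    change _ = ρ (G.u i j) (finRotate K s) ((finRotate K).symm (finRotate K s))
    rw [Equiv.symm_apply_apply]
  · exact h i j r s hrs

lemma IsModel.isCyclicRep {g : UnitaryPow N K} {ρ : A →⋆ₐ[ℂ] Matrix (Fin K) (Fin K) ℂ}
    (h : G.IsModel g ρ) : G.IsCyclicRep ρ := fun i j k l hkl => by
  rw [h i j, cycleMatrix, if_neg hkl]

/-- A bounded representation of the dense algebra of coordinates extends to `C(G)`. -/
lemma exists_extension (σ : coordAlg G.u →⋆ₐ[ℂ] Matrix (Fin K) (Fin K) ℂ)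
    (hσ : ∀ x r s, ‖σ x r s‖ ≤ ‖(x : A)‖) :
    ∃ ρ : A →⋆ₐ[ℂ] Matrix (Fin K) (Fin K) ℂ, ∀ x : coordAlg G.u, ρ x = σ x := by
  let ι : coordAlg G.u →L[ℂ] A :=
    ⟨(coordAlg G.u).subtype.toAlgHom.toLinearMap, continuous_subtype_val⟩
  have hdense : DenseRange ι := G.denseRange_coordAlg
  have hι : IsUniformInducing ι := isUniformEmbedding_subtype_val.isUniformInducing
  let f : Fin K → Fin K → (coordAlg G.u →L[ℂ] ℂ) := fun r s => LinearMap.mkContinuous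
    { toFun := fun a => σ a r s
      map_add' := fun a b => by rw [map_add, Matrix.add_apply]
      map_smul' := fun c a => by rw [map_smul, Matrix.smul_apply]; rfl } 1
    fun a => by rw [one_mul]; exact hσ a r s
  let F : Fin K → Fin K → (A →L[ℂ] ℂ) := fun r s => (f r s).extend ι
  have hF : ∀ r s (x : coordAlg G.u), F r s x = σ x r s := fun r s x =>
    ContinuousLinearMap.extend_eq (f r s) hdense hι x
  let L : A →ₗ[ℂ] Matrix (Fin K) (Fin K) ℂ :=
    { toFun := fun a => Matrix.of fun r s => F r s a
      map_add' := fun a b => by ext; simp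
      map_smul' := fun c a => by ext; simp }
  have hL : ∀ a r s, L a r s = F r s a := fun _ _ _ => rfl
  have hLx : ∀ x : coordAlg G.u, L x = σ x := fun x => by
    ext r s; rw [hL, hF]
  have h1 : L 1 = 1 := by
    have := hLx 1
    rwa [map_one] at this
  have hmul : ∀ a b, L (a * b) = L a * L b := fun a b => by
    ext r s
    refine G.denseRange_coordAlg.induction_on₂
      (p := fun a b => L (a * b) r s = (L a * L b) r s) ?_ (fun x y => ?_) a b
    · simp only [Matrix.mul_apply, hL]
      exact isClosed_eq (by fun_prop) (by fun_prop)
    · rw [hLx, hLx, ← map_mul, ← hLx]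
      rfl
  have hstar : ∀ a, L (star a) = star (L a) := fun a => by
    ext r s
    refine G.denseRange_coordAlg.induction_on
      (p := fun a => L (star a) r s = star (L a) r s) a ?_ (fun x => ?_)
    · simp only [Matrix.star_apply, hL]
      exact isClosed_eq (by fun_prop) (by fun_prop)
    · rw [hLx, ← map_star, ← hLx]
      rfl
  exact ⟨{ AlgHom.ofLinearMap L h1 hmul with map_star' := hstar }, hLx⟩

/-- Contractivity of `Δ` for the spatial norm, tested on the cyclic vector `s = 1` of a product
state. -/
lemma prodFunctional_comul_le {φ ψ : A →L[ℂ] ℂ} (hφ : IsState φ) (hψ : IsState ψ)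
    (x : coordAlg G.u) :
    (prodFunctional φ ψ (G.comul (star x * x))).re ≤ ‖(x : A)‖ ^ 2 := by
  have h1 : (prodFunctional φ ψ (star 1 * 1)).re ≤ 1 := by
    rw [star_one, one_mul, Algebra.TensorProduct.one_def, prodFunctional_tmul, hφ.1, hψ.1]
    simp
  have h2 : ENNReal.ofReal (Real.sqrt
      (prodFunctional φ ψ (star (G.comul x * 1) * (G.comul x * 1))).re) ≤
      spatialNorm (G.comul x) := by
    unfold spatialNorm
    refine le_iSup_of_le φ <| le_iSup_of_le hφ <| le_iSup_of_le ψ <| le_iSup_of_le hψ <|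
      le_iSup_of_le 1 <| le_iSup_of_le h1 le_rfl
  have h3 := h2.trans (G.comul_le x)
  rw [ENNReal.ofReal_le_ofReal_iff (norm_nonneg _), mul_one, ← map_star, ← map_mul] at h3
  exact (Real.sqrt_le_left (norm_nonneg _)).1 h3

/-- Under `(ρ ⊗ ρ')Δ` the coordinates shift both tensor legs simultaneously, so the span of the `e_s
⊗ e_s` is invariant, and there `∑ u_ik ⊗ u_kj` becomes the cycle filled with the entries of `g g'`.
The coefficient formula is kept for the integration over the group. -/
theorem IsModel.exists_mul {g g' : UnitaryPow N K} {ρ ρ' : A →⋆ₐ[ℂ] Matrix (Fin K) (Fin K) ℂ}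
    (h : G.IsModel g ρ) (h' : G.IsModel g' ρ') :
    ∃ ρ'' : A →⋆ₐ[ℂ] Matrix (Fin K) (Fin K) ℂ, G.IsModel (g * g') ρ'' ∧
      ∀ (x : coordAlg G.u) (r s : Fin K),
        ρ'' x r s = prodFunctional (coeffCLM ρ r s) (coeffCLM ρ' r s) (G.comul x) := by
  let D : coordAlg G.u →⋆ₐ[ℂ] Matrix (Fin K × Fin K) (Fin K × Fin K) ℂ :=
    { (tensorRep ρ ρ').comp G.comul.toAlgHom with
      map_star' := fun x => by
        change tensorRep ρ ρ' (G.comul (star x)) = star (tensorRep ρ ρ' (G.comul x))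
        rw [map_star, tensorRep_star] }
  have hDx : ∀ x, D x = tensorRep ρ ρ' (G.comul x) := fun _ => rfl
  have hDu : ∀ i j r p s q, D (coord G.u i j) (r, p) (s, q) =
      if r = finRotate K s ∧ p = finRotate K q then
        ∑ k, (g r : Matrix (Fin N) (Fin N) ℂ) i k * (g' p : Matrix (Fin N) (Fin N) ℂ) k j
      else 0 := fun i j r p s q => by
    rw [hDx, G.comul_coord, map_sum, Matrix.sum_apply]
    simp only [tensorRep_apply, prodFunctional_tmul, coeffCLM_apply, h _ _, h' _ _, cycleMatrix]
    by_cases h1 : r = finRotate K s <;> by_cases h2 : p = finRotate K q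
    · simp only [h1, h2, and_self, if_true]
    · simp only [h1, h2, and_false, if_false, mul_zero, Finset.sum_const_zero]
    · simp only [h1, h2, false_and, if_false, zero_mul, Finset.sum_const_zero]
    · simp only [h1, h2, and_false, if_false, mul_zero, Finset.sum_const_zero]
  -- Invariance of the diagonal is proved for `x` and `star x` together, so that the induction
  -- survives the adjoint.
  have hD : ∀ x, (∀ r p s, r ≠ p → D x (r, p) (s, s) = 0) ∧
      ∀ r p s, r ≠ p → D (star x) (r, p) (s, s) = 0 := by
    intro x
    refine coordAlg_induction
      (p := fun x : coordAlg G.u => (∀ r p s, r ≠ p → D x (r, p) (s, s) = 0) ∧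
        ∀ r p s, r ≠ p → D (star x) (r, p) (s, s) = 0) ?_ ?_ ?_ ?_ ?_ x
    · intro i j
      refine ⟨fun r p s hrp => ?_, fun r p s hrp => ?_⟩
      · rw [hDu, if_neg]
        rintro ⟨rfl, rfl⟩; exact hrp rfl
      · rw [map_star, Matrix.star_apply, hDu, if_neg, star_zero]
        rintro ⟨rfl, h2⟩; exact hrp ((finRotate K).injective h2)
    · intro c
      refine ⟨fun r p s hrp => ?_, fun r p s hrp => ?_⟩
      · rw [AlgHomClass.commutes, Matrix.algebraMap_matrix_apply, if_neg]
        intro h; exact hrp (by simp_all [Prod.ext_iff])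
      · rw [← algebraMap_star_comm, AlgHomClass.commutes, Matrix.algebraMap_matrix_apply, if_neg]
        intro h; exact hrp (by simp_all [Prod.ext_iff])
    · intro x y hx hy
      refine ⟨fun r p s hrp => ?_, fun r p s hrp => ?_⟩
      · rw [map_add, Matrix.add_apply, hx.1 r p s hrp, hy.1 r p s hrp, add_zero]
      · rw [star_add, map_add, Matrix.add_apply, hx.2 r p s hrp, hy.2 r p s hrp, add_zero]
    · have key : ∀ x y : coordAlg G.u, (∀ r p s, r ≠ p → D x (r, p) (s, s) = 0) →
          (∀ r p s, r ≠ p → D y (r, p) (s, s) = 0) →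
          ∀ r p s, r ≠ p → D (x * y) (r, p) (s, s) = 0 := by
        intro x y hx hy r p s hrp
        rw [map_mul, Matrix.mul_apply]
        refine Finset.sum_eq_zero fun q _ => ?_
        obtain ⟨q₁, q₂⟩ := q
        by_cases hq : q₁ = q₂
        · subst hq; rw [hx r p q₁ hrp, zero_mul]
        · rw [hy q₁ q₂ s hq, mul_zero]
      intro x y hx hy
      refine ⟨key x y hx.1 hy.1, ?_⟩
      rw [star_mul]
      exact key _ _ hy.2 hx.2
    · intro x hx
      exact ⟨hx.2, by rw [star_star]; exact hx.1⟩
  let σ := diagRep D fun x => (hD x).1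
  have hσ : ∀ x r s, σ x r s =
      prodFunctional (coeffCLM ρ r s) (coeffCLM ρ' r s) (G.comul x) := fun _ _ _ => rfl
  -- The squared norm of column `s` of `σ x` is the value of a product of vector states at `Δ(x*
  -- x)`, hence at most `‖x‖²`.
  obtain ⟨ρ'', hρ''⟩ := exists_extension σ fun x r s => by
    have h1 := prodFunctional_comul_le (isState_coeffCLM ρ s) (isState_coeffCLM ρ' s) x
    rw [← hσ, map_mul, map_star, Matrix.mul_apply, Complex.re_sum] at h1
    have h2 : ∀ t, ((star (σ x)) s t * σ x t s).re = ‖σ x t s‖ ^ 2 := fun t => by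
      rw [Matrix.star_apply, Complex.star_def, Complex.conj_mul']
      exact_mod_cast rfl
    simp only [h2] at h1
    have h3 := (Finset.single_le_sum (f := fun t => ‖σ x t s‖ ^ 2) (fun t _ => by positivity)
      (Finset.mem_univ r)).trans h1
    exact (pow_le_pow_iff_left₀ (norm_nonneg _) (norm_nonneg _) two_ne_zero).1 h3
  refine ⟨ρ'', fun i j => ?_, fun x r s => by rw [hρ'', hσ]⟩
  have h1 : ρ'' (G.u i j) = σ (coord G.u i j) := hρ'' (coord G.u i j)
  ext r s
  rw [h1]
  change D (coord G.u i j) (r, r) (s, s) = _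
  simp only [hDu, cycleMatrix, and_self]
  rfl

/-- The antipode and the transpose both reverse products, so their composite with `ρ` is a
homomorphism. It sends `u_ij` to the entrywise conjugate of `ρ(u_ji)`. -/
theorem IsModel.exists_inv {g : UnitaryPow N K} {ρ : A →⋆ₐ[ℂ] Matrix (Fin K) (Fin K) ℂ}
    (h : G.IsModel g ρ) :
    ∃ ρ' : A →⋆ₐ[ℂ] Matrix (Fin K) (Fin K) ℂ, G.IsModel g⁻¹ ρ' := by
  let ρ' : A →⋆ₐ[ℂ] Matrix (Fin K) (Fin K) ℂ :=
    { toFun := fun a => (ρ (G.antipode a).unop).transpose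
      map_one' := by simp
      map_mul' := fun a b => by simp [Matrix.transpose_mul]
      map_zero' := by simp
      map_add' := fun a b => by simp
      commutes' := fun c => by
        rw [AlgHomClass.commutes, MulOpposite.algebraMap_apply, MulOpposite.unop_op,
          AlgHomClass.commutes]
        ext r s
        simp only [Matrix.transpose_apply, Matrix.algebraMap_matrix_apply, eq_comm]
      map_star' := fun a => by
        rw [map_star, MulOpposite.unop_star, map_star]; rfl }
  refine ⟨ρ', fun i j => ?_⟩
  change (ρ (G.antipode (G.u i j)).unop).transpose = _
  rw [G.antipode_coord, MulOpposite.unop_op, map_star, h]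
  ext r s
  rw [Matrix.transpose_apply, Matrix.star_apply, cycleMatrix, cycleMatrix]
  split_ifs
  · rfl
  · simp

/-- Conjugation by the cyclic permutation matrix preserves the cycle's support and rotates its
entries. -/
theorem IsModel.exists_rotate {g : UnitaryPow N K} {ρ : A →⋆ₐ[ℂ] Matrix (Fin K) (Fin K) ℂ}
    (h : G.IsModel g ρ) :
    ∃ ρ' : A →⋆ₐ[ℂ] Matrix (Fin K) (Fin K) ℂ, G.IsModel (fun r => g (finRotate K r)) ρ' := by
  let ρ' : A →⋆ₐ[ℂ] Matrix (Fin K) (Fin K) ℂ :=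
    { toFun := fun a => (ρ a).submatrix (finRotate K) (finRotate K)
      map_one' := by simp
      map_mul' := fun a b => by
        rw [map_mul, Matrix.submatrix_mul_equiv]
      map_zero' := by simp
      map_add' := fun a b => by rw [map_add]; rfl
      commutes' := fun c => by
        ext
        simp [AlgHomClass.commutes, Matrix.algebraMap_matrix_apply]
      map_star' := fun a => by ext; simp [map_star, Matrix.star_apply] }
  refine ⟨ρ', fun i j => ?_⟩
  change (ρ (G.u i j)).submatrix _ _ = _
  ext r s
  rw [h]
  simp [cycleMatrix, -finRotate_apply]

end CompactMatrixQuantumGroup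

section Topology

instance compactSpace_unitaryGroup {N : ℕ} : CompactSpace (Matrix.unitaryGroup (Fin N) ℂ) := by
  suffices h : IsCompact ((Matrix.unitaryGroup (Fin N) ℂ : Submonoid _) :
      Set (Matrix (Fin N) (Fin N) ℂ)) from isCompact_iff_compactSpace.1 h
  have hK : IsCompact (X := Matrix (Fin N) (Fin N) ℂ) (Set.pi Set.univ fun _ : Fin N =>
      Set.pi Set.univ fun _ : Fin N => Metric.closedBall (0 : ℂ) 1) :=
    isCompact_univ_pi fun _ => isCompact_univ_pi fun _ => isCompact_closedBall _ _
  refine hK.of_isClosed_subset ?_ ?_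
  · have : ((Matrix.unitaryGroup (Fin N) ℂ : Submonoid _) : Set (Matrix (Fin N) (Fin N) ℂ)) =
        {M | M * star M = 1} := by
      ext M
      exact Matrix.mem_unitaryGroup_iff
    rw [this]
    exact isClosed_eq (continuous_id.mul continuous_star) continuous_const
  · intro M hM i _ j _
    rw [mem_closedBall_zero_iff]
    exact entry_norm_bound_of_unitary hM i j

end Topology

/-! ### The group `L`, its matrix model and the integrals of diagonal coefficients. -/

namespace CompactMatrixQuantumGroup

variable {N K : ℕ} {A : Type*} [CStarAlgebra A] (G : CompactMatrixQuantumGroup N A)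

/-- The closed subgroup of `U_N ^ K` formed by the points which define representations of
`C(G)`. -/
def modelGroup (hG : ∃ (g : UnitaryPow N K) (ρ : _), G.IsModel g ρ) :
    Subgroup (UnitaryPow N K) where
  carrier := {g | ∃ ρ, G.IsModel g ρ}
  mul_mem' := by
    rintro g g' ⟨ρ, h⟩ ⟨ρ', h'⟩
    obtain ⟨ρ'', h'', -⟩ := h.exists_mul h'
    exact ⟨ρ'', h''⟩
  -- The identity point must send `u_ij` to `δ_ij` times the cycle, which for `K > 1` is not the
  -- counit. It is reached instead as `g g⁻¹` from some existing point.
  one_mem' := by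
    obtain ⟨g, ρ, h⟩ := hG
    obtain ⟨ρ', h'⟩ := h.exists_inv
    obtain ⟨ρ'', h'', -⟩ := h.exists_mul h'
    exact ⟨ρ'', by rwa [mul_inv_cancel] at h''⟩
  inv_mem' := by
    rintro g ⟨ρ, h⟩
    exact h.exists_inv

open Filter Topology in
-- Along an ultrafilter of points the coefficients of `a` stay in the disc of radius `‖a‖`, so they
-- converge. The limits again form a `*`-representation, attached to the limit point.
lemma isClosed_setOf_isModel :
    IsClosed {g : UnitaryPow N K | ∃ ρ, G.IsModel g ρ} := by
  classical
  rw [isClosed_iff_ultrafilter]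
  intro g₀ F hF hmem
  -- The default value `0` never matters, as the ultrafilter contains the set of model points.
  let f : A → Fin K → Fin K → UnitaryPow N K → ℂ := fun a r s g =>
    if h : ∃ ρ, G.IsModel g ρ then h.choose a r s else 0
  have hf : ∀ᶠ g in (F : Filter (UnitaryPow N K)), ∃ ρ, G.IsModel g ρ ∧
      ∀ a r s, f a r s g = ρ a r s := by
    filter_upwards [hmem] with g hg
    have hg' : ∃ ρ, G.IsModel g ρ := hg
    exact ⟨hg'.choose, hg'.choose_spec, fun a r s => by simp only [f, dif_pos hg']⟩
  have hlim : ∀ a r s, ∃ z, Tendsto (f a r s) F (𝓝 z) := fun a r s => by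
    obtain ⟨z, -, hz⟩ := (isCompact_closedBall (0 : ℂ) ‖a‖).ultrafilter_le_nhds
      (F.map (f a r s)) (by
        rw [le_principal_iff]
        refine Filter.mem_map.2 (Filter.mem_of_superset hf ?_)
        rintro g ⟨ρ, -, h⟩
        rw [Set.mem_preimage, mem_closedBall_zero_iff, h]
        exact norm_rep_apply_le ρ a r s)
    exact ⟨z, hz⟩
  choose z hz using hlim
  have uniq : ∀ {p q : UnitaryPow N K → ℂ} {v w : ℂ}, Tendsto p F (𝓝 v) → Tendsto q F (𝓝 w) →
      (∀ g ρ, G.IsModel g ρ → (∀ a r s, f a r s g = ρ a r s) → p g = q g) → v = w := by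
    intro p q v w hp hq h
    refine tendsto_nhds_unique_of_eventuallyEq hp hq ?_
    filter_upwards [hf] with g ⟨ρ, hρ, hρf⟩
    exact h g ρ hρ hρf
  let L : A →ₗ[ℂ] Matrix (Fin K) (Fin K) ℂ :=
    { toFun := fun a => Matrix.of fun r s => z a r s
      map_add' := fun a b => by
        ext r s
        refine uniq (hz (a + b) r s) ((hz a r s).add (hz b r s)) fun g ρ _ h => ?_
        rw [h, h, h, map_add, Matrix.add_apply]
      map_smul' := fun c a => by
        ext r s
        refine uniq (hz (c • a) r s) ((hz a r s).const_smul c) fun g ρ _ h => ?_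
        rw [h, h, map_smul, Matrix.smul_apply] }
  have hL1 : L 1 = 1 := by
    ext r s
    refine uniq (hz 1 r s) tendsto_const_nhds fun g ρ _ h => ?_
    rw [h, map_one]
  have hLmul : ∀ a b, L (a * b) = L a * L b := fun a b => by
    ext r s
    rw [Matrix.mul_apply]
    refine uniq (hz (a * b) r s)
      (tendsto_finsetSum _ fun t _ => (hz a r t).mul (hz b t s)) fun g ρ _ h => ?_
    simp only [h]
    rw [map_mul, Matrix.mul_apply]
  have hLstar : ∀ a, L (star a) = star (L a) := fun a => by
    ext r s
    rw [Matrix.star_apply]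
    refine uniq (hz (star a) r s) (hz a s r).star fun g ρ _ h => ?_
    rw [h, h, map_star, Matrix.star_apply]
  refine ⟨{ AlgHom.ofLinearMap L hL1 hLmul with map_star' := hLstar }, fun i j => ?_⟩
  change L (G.u i j) = _
  ext r s
  have hcont : Continuous fun g : UnitaryPow N K =>
      cycleMatrix (fun r => (g r : Matrix (Fin N) (Fin N) ℂ) i j) r s := by
    unfold cycleMatrix
    split_ifs
    · exact (continuous_subtype_val.comp (continuous_apply r)).matrix_elem i j
    · exact continuous_const
  refine uniq (hz _ r s) ((hcont.tendsto g₀).mono_left hF) fun g ρ hρ h => ?_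
  rw [h, hρ]

section ModelGroup

variable {G} (hG : ∃ (g : UnitaryPow N K) (ρ : _), G.IsModel g ρ)

/-- The representation attached to a point of the model group. -/
def rep (g : G.modelGroup hG) : A →⋆ₐ[ℂ] Matrix (Fin K) (Fin K) ℂ := g.2.choose

lemma isModel_rep (g : G.modelGroup hG) : G.IsModel (g : UnitaryPow N K) (rep hG g) :=
  g.2.choose_spec

lemma isClosed_modelGroup : IsClosed (G.modelGroup hG : Set (UnitaryPow N K)) :=
  G.isClosed_setOf_isModel

lemma isCyclicStable_modelGroup : IsCyclicStable (G.modelGroup hG) := by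
  rintro g ⟨ρ, h⟩
  exact h.exists_rotate

lemma rep_eq_of_isModel {g : G.modelGroup hG} {ρ : A →⋆ₐ[ℂ] Matrix (Fin K) (Fin K) ℂ}
    (h : G.IsModel (g : UnitaryPow N K) ρ) : rep hG g = ρ :=
  (isModel_rep hG g).ext h

lemma rep_mul_apply (g g' : G.modelGroup hG) (x : coordAlg G.u) (r s : Fin K) :
    rep hG (g * g') x r s =
      prodFunctional (coeffCLM (rep hG g) r s) (coeffCLM (rep hG g') r s) (G.comul x) := by
  obtain ⟨ρ, h, hρ⟩ := (isModel_rep hG g).exists_mul (isModel_rep hG g')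
  rw [rep_eq_of_isModel hG (g := g * g') h, hρ]

/-- Clear for coordinates. Since `|ρ_g(a)_{rs}| ≤ ‖a‖` uniformly in `g`, norm limits in `A` give
uniform limits of functions on the group. -/
lemma continuous_rep (a : A) (r s : Fin K) : Continuous fun g => rep hG g a r s := by
  refine closed_induction (G := G)
    (p := fun a => ∀ r s, Continuous fun g => rep hG g a r s) ?_ ?_ ?_ ?_ ?_ ?_ a r s
  · refine isClosed_of_closure_subset fun a ha r s => ?_
    refine continuous_of_uniform_approx_of_continuous fun u hu => ?_
    obtain ⟨ε, hε, hu⟩ := Metric.mem_uniformity_dist.1 hu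
    obtain ⟨b, hb, hab⟩ := Metric.mem_closure_iff.1 ha ε hε
    refine ⟨_, hb r s, fun g => hu ?_⟩
    rw [dist_eq_norm] at hab ⊢
    rw [← Matrix.sub_apply, ← map_sub]
    exact (norm_rep_apply_le _ _ r s).trans_lt hab
  · intro i j r s
    simp only [isModel_rep hG _ i j]
    unfold cycleMatrix
    split_ifs
    · exact (component _ r i j).continuous
    · exact continuous_const
  · intro c r s
    simp only [AlgHomClass.commutes]
    exact continuous_const
  · intro a b ha hb r s
    simp only [map_add, Matrix.add_apply]
    exact (ha r s).add (hb r s)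
  · intro a b ha hb r s
    simp only [map_mul, Matrix.mul_apply]
    exact continuous_finsetSum _ fun t _ => (ha r t).mul (hb t s)
  · intro a ha r s
    simp only [map_star, Matrix.star_apply]
    exact (ha s r).star

/-- The matrix model `C(G) → M_K(C(L))`. -/
def model : A →⋆ₐ[ℂ] Matrix (Fin K) (Fin K) C(G.modelGroup hG, ℂ) where
  toFun a := Matrix.of fun r s => ⟨fun g => rep hG g a r s, continuous_rep hG a r s⟩
  map_one' := by
    ext r s g
    simp only [Matrix.of_apply, ContinuousMap.coe_mk, map_one, Matrix.one_apply]
    split_ifs <;> rfl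
  map_mul' a b := by
    ext r s g
    simp only [Matrix.of_apply, ContinuousMap.coe_mk, map_mul, Matrix.mul_apply,
      ContinuousMap.coe_sum, Finset.sum_apply, ContinuousMap.mul_apply]
  map_zero' := by
    ext r s g
    simp
  map_add' a b := by
    ext r s g
    simp
  commutes' c := by
    ext r s g
    simp only [Matrix.of_apply, ContinuousMap.coe_mk, AlgHomClass.commutes,
      Matrix.algebraMap_matrix_apply]
    split_ifs <;> rfl
  map_star' a := by
    ext r s g
    simp [map_star, Matrix.star_apply]

lemma model_apply (a : A) (r s : Fin K) (g : G.modelGroup hG) :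
    model hG a r s g = rep hG g a r s := rfl

lemma model_coord (i j : Fin N) :
    model hG (G.u i j) = cycleMatrix fun r => component (G.modelGroup hG) r i j := by
  ext r s g
  rw [model_apply, isModel_rep hG g i j, cycleMatrix, cycleMatrix]
  split_ifs <;> rfl

lemma continuous_prodFunctional_rep (r : Fin K) (t : A ⊗[ℂ] A) :
    Continuous fun p : G.modelGroup hG × G.modelGroup hG =>
      prodFunctional (coeffCLM (rep hG p.1) r r) (coeffCLM (rep hG p.2) r r) t := by
  induction t with
  | zero => simpa using continuous_const
  | add t t' h h' =>
    simp only [map_add]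
    exact h.add h'
  | tmul a b =>
    simp only [prodFunctional_tmul, coeffCLM_apply]
    exact ((continuous_rep hG a r r).comp continuous_fst).mul
      ((continuous_rep hG b r r).comp continuous_snd)

instance compactSpace_modelGroup : CompactSpace (G.modelGroup hG) :=
  isCompact_iff_compactSpace.1 (isClosed_modelGroup hG).isCompact

variable [MeasurableSpace (G.modelGroup hG)] [BorelSpace (G.modelGroup hG)]
  (μ : Measure (G.modelGroup hG)) [IsProbabilityMeasure μ]

lemma integrable_of_continuous {f : G.modelGroup hG → ℂ} (hf : Continuous f) : Integrable f μ :=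
  hf.integrable_of_hasCompactSupport (HasCompactSupport.of_compactSpace f)

/-- The integral over the model group of a diagonal coefficient of the model. -/
def diagIntegral (r : Fin K) : A →L[ℂ] ℂ :=
  LinearMap.mkContinuous
    { toFun := fun a => ∫ g, rep hG g a r r ∂μ
      map_add' := fun a b => by
        simp only [map_add, Matrix.add_apply]
        exact integral_add (integrable_of_continuous hG μ (continuous_rep hG a r r))
          (integrable_of_continuous hG μ (continuous_rep hG b r r))
      map_smul' := fun c a => by
        simp only [map_smul, Matrix.smul_apply]
        exact integral_smul c _ } 1
    fun a => by
      have := norm_integral_le_of_norm_le_const (μ := μ) (f := fun g => rep hG g a r r)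
        (Filter.Eventually.of_forall fun g => norm_rep_apply_le (rep hG g) a r r)
      simpa using this

lemma diagIntegral_apply (r : Fin K) (a : A) :
    diagIntegral hG μ r a = ∫ g, rep hG g a r r ∂μ := rfl

lemma isState_diagIntegral (r : Fin K) : IsState (diagIntegral hG μ r) := by
  refine ⟨by simp [diagIntegral_apply], fun a => ?_⟩
  rw [diagIntegral_apply]
  exact integral_nonneg fun g => (isState_coeffCLM (rep hG g) r).2 a

/-- For `t = Δ(x)` the integrand is `ρ_{g g₀}(x)_{rr}`, so the slice of `Δ(x)` becomes a translated
integral. -/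
lemma rep_lid_rTensor (r : Fin K) (g₀ : G.modelGroup hG) (t : A ⊗[ℂ] A) :
    rep hG g₀ (TensorProduct.lid ℂ A
      (LinearMap.rTensor A (diagIntegral hG μ r : A →ₗ[ℂ] ℂ) t)) r r =
      ∫ g, prodFunctional (coeffCLM (rep hG g) r r) (coeffCLM (rep hG g₀) r r) t ∂μ := by
  induction t with
  | zero => simp
  | add t t' h h' =>
    simp only [map_add, Matrix.add_apply, h, h']
    have hc := fun t => integrable_of_continuous hG μ
      ((continuous_prodFunctional_rep hG r t).comp (Continuous.prodMk_left g₀))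
    exact (integral_add (hc t) (hc t')).symm
  | tmul a b =>
    simp only [LinearMap.rTensor_tmul, TensorProduct.lid_tmul, map_smul, Matrix.smul_apply,
      prodFunctional_tmul, coeffCLM_apply, ContinuousLinearMap.coe_coe, diagIntegral_apply,
      smul_eq_mul]
    exact (integral_mul_const _ _).symm

lemma rep_rid_lTensor (r : Fin K) (g₀ : G.modelGroup hG) (t : A ⊗[ℂ] A) :
    rep hG g₀ (TensorProduct.rid ℂ A
      (LinearMap.lTensor A (diagIntegral hG μ r : A →ₗ[ℂ] ℂ) t)) r r =
      ∫ g, prodFunctional (coeffCLM (rep hG g₀) r r) (coeffCLM (rep hG g) r r) t ∂μ := by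
  induction t with
  | zero => simp
  | add t t' h h' =>
    simp only [map_add, Matrix.add_apply, h, h']
    have hc := fun t => integrable_of_continuous hG μ
      ((continuous_prodFunctional_rep hG r t).comp (Continuous.prodMk_right g₀))
    exact (integral_add (hc t) (hc t')).symm
  | tmul a b =>
    simp only [LinearMap.lTensor_tmul, TensorProduct.rid_tmul, map_smul, Matrix.smul_apply,
      prodFunctional_tmul, coeffCLM_apply, ContinuousLinearMap.coe_coe, diagIntegral_apply,
      smul_eq_mul]
    rw [mul_comm]
    exact (integral_const_mul _ _).symm

end ModelGroup

/-! ### The automorphism against the comultiplication and the cyclic representations. -/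

section Symmetry

variable {G} {α : A ≃⋆ₐ[ℂ] A} {ω : ℂ}

/-- In a cyclic representation `α` is conjugation by `diag(ω^k)`, since the entries of `ρ(u_ij)` sit
where `k - l ≡ 1` modulo `K`. In particular diagonal coefficients are `α`-invariant. -/
lemma IsCyclicRep.apply_aut {ρ : A →⋆ₐ[ℂ] Matrix (Fin K) (Fin K) ℂ} (h : G.IsCyclicRep ρ)
    (hK : K ≠ 0) (hω : IsPrimitiveRoot ω K) (hα : ∀ i j, α (G.u i j) = ω • G.u i j) (a : A)
    (k l : Fin K) : ρ (α a) k l = ω ^ ((k : ℤ) - l) * ρ a k l := by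
  have hne := hω.ne_zero hK
  have hstar : star ω = ω⁻¹ := by
    rw [Complex.inv_def, Complex.normSq_eq_norm_sq, hω.norm'_eq_one hK]; simp
  refine closed_induction (G := G)
    (p := fun a => ∀ k l : Fin K, ρ (α a) k l = ω ^ ((k : ℤ) - l) * ρ a k l)
    ?_ ?_ ?_ ?_ ?_ ?_ a k l
  · have : {a | ∀ k l : Fin K, ρ (α a) k l = ω ^ ((k : ℤ) - l) * ρ a k l} =
        ⋂ k, ⋂ l, {a | coeffCLM ρ k l (α a) = ω ^ ((k : ℤ) - l) * coeffCLM ρ k l a} := by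
      ext a
      simp
    rw [this]
    exact isClosed_iInter fun k => isClosed_iInter fun l => isClosed_eq
      ((coeffCLM ρ k l).continuous.comp (StarAlgEquiv.isometry α).continuous)
      (continuous_const.mul (coeffCLM ρ k l).continuous)
  · intro i j k l
    rw [hα, map_smul, Matrix.smul_apply, smul_eq_mul]
    by_cases hkl : k = finRotate K l
    · have h1 : ω ^ ((k : ℤ) - l - 1) = 1 := by
        rw [hω.zpow_eq_one_iff_dvd, hkl, sub_sub, add_comm (l : ℤ)]
        exact dvd_finRotate_sub l
      rw [← sub_add_cancel ((k : ℤ) - l) 1, zpow_add₀ hne, h1, one_mul, zpow_one]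
    · rw [h i j k l hkl, mul_zero, mul_zero]
  · intro c k l
    simp only [AlgHomClass.commutes, Matrix.algebraMap_matrix_apply]
    split_ifs with hkl
    · simp [hkl]
    · simp
  · intro a b ha hb k l
    rw [map_add, map_add, map_add, Matrix.add_apply, Matrix.add_apply, ha, hb, mul_add]
  · intro a b ha hb k l
    rw [map_mul, map_mul, map_mul, Matrix.mul_apply, Matrix.mul_apply, Finset.mul_sum]
    refine Finset.sum_congr rfl fun m _ => ?_
    rw [ha, hb, ← sub_add_sub_cancel (k : ℤ) m l, zpow_add₀ hne]
    ring
  · intro a ha k l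
    rw [map_star, map_star, map_star, Matrix.star_apply, Matrix.star_apply, ha, star_mul',
      star_zpow₀, hstar, inv_zpow', neg_sub]

lemma map_aut_symm_star (t : A ⊗[ℂ] A) :
    Algebra.TensorProduct.map (α : A →⋆ₐ[ℂ] A).toAlgHom (α.symm : A →⋆ₐ[ℂ] A).toAlgHom (star t) =
    star (Algebra.TensorProduct.map (α : A →⋆ₐ[ℂ] A).toAlgHom
      (α.symm : A →⋆ₐ[ℂ] A).toAlgHom t) := by
  induction t with
  | zero => simp
  | add t t' h h' => rw [star_add, map_add, map_add, star_add, h, h']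
  | tmul a b =>
    rw [TensorProduct.star_tmul, Algebra.TensorProduct.map_tmul, Algebra.TensorProduct.map_tmul,
      TensorProduct.star_tmul]
    congr 1
    · exact map_star α a
    · exact map_star α.symm b

/-- On `u_ik ⊗ u_kj` the two scalars `ω` and `ω⁻¹` cancel. -/
lemma map_aut_symm_comul (hω : ω ≠ 0) (hα : ∀ i j, α (G.u i j) = ω • G.u i j)
    (x : coordAlg G.u) :
    Algebra.TensorProduct.map (α : A →⋆ₐ[ℂ] A).toAlgHom (α.symm : A →⋆ₐ[ℂ] A).toAlgHom
      (G.comul x) = G.comul x := by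
  have hα' : ∀ i j, α.symm (G.u i j) = ω⁻¹ • G.u i j := fun i j => by
    apply α.injective
    change α (α.symm (G.u i j)) = α (ω⁻¹ • G.u i j)
    rw [StarAlgEquiv.apply_symm_apply, map_smul, hα, inv_smul_smul₀ hω]
  refine coordAlg_induction (p := fun x => Algebra.TensorProduct.map (α : A →⋆ₐ[ℂ] A).toAlgHom
    (α.symm : A →⋆ₐ[ℂ] A).toAlgHom (G.comul x) = G.comul x) ?_ ?_ ?_ ?_ ?_ x
  · intro i j
    rw [G.comul_coord, map_sum]
    refine Finset.sum_congr rfl fun k _ => ?_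
    rw [Algebra.TensorProduct.map_tmul]
    change α (G.u i k) ⊗ₜ[ℂ] α.symm (G.u k j) = _
    rw [hα, hα', TensorProduct.smul_tmul_smul, mul_inv_cancel₀ hω, one_smul]
  · intro c
    rw [AlgHomClass.commutes, AlgHomClass.commutes]
  · intro a b ha hb
    rw [map_add, map_add, ha, hb]
  · intro a b ha hb
    rw [map_mul, map_mul, ha, hb]
  · intro a ha
    rw [map_star, map_aut_symm_star, ha]

/-- Invariance of `φ` gives `φ ⊗ id = α (φ ⊗ id)(α ⊗ α⁻¹)`, and `α ⊗ α⁻¹` fixes `Δ(x)`. This places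
the slice where cyclic representations separate. -/
lemma lid_rTensor_comul_mem_grade (hω : ω ≠ 0) (hα : ∀ i j, α (G.u i j) = ω • G.u i j)
    {φ : A →ₗ[ℂ] ℂ} (hφ : ∀ a, φ (α a) = φ a) (x : coordAlg G.u) :
    TensorProduct.lid ℂ A (LinearMap.rTensor A φ (G.comul x)) ∈ grade α ω 0 := by
  have key : ∀ t : A ⊗[ℂ] A, TensorProduct.lid ℂ A (LinearMap.rTensor A φ t) =
      α (TensorProduct.lid ℂ A (LinearMap.rTensor A φ (Algebra.TensorProduct.map
        (α : A →⋆ₐ[ℂ] A).toAlgHom (α.symm : A →⋆ₐ[ℂ] A).toAlgHom t))) := fun t => by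
    induction t with
    | zero => simp
    | add t t' h h' => simp only [map_add, ← h, ← h']
    | tmul a b =>
      rw [Algebra.TensorProduct.map_tmul, LinearMap.rTensor_tmul, LinearMap.rTensor_tmul,
        TensorProduct.lid_tmul, TensorProduct.lid_tmul, map_smul]
      change φ a • b = φ (α a) • α (α.symm b)
      rw [hφ, StarAlgEquiv.apply_symm_apply]
  have h := key (G.comul x)
  rw [map_aut_symm_comul hω hα] at h
  rw [mem_grade, zpow_zero, one_smul, ← h]

lemma rid_lTensor_comul_mem_grade (hω : ω ≠ 0) (hα : ∀ i j, α (G.u i j) = ω • G.u i j)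
    {φ : A →ₗ[ℂ] ℂ} (hφ : ∀ a, φ (α a) = φ a) (x : coordAlg G.u) :
    TensorProduct.rid ℂ A (LinearMap.lTensor A φ (G.comul x)) ∈ grade α ω 0 := by
  have key : ∀ t : A ⊗[ℂ] A, α (TensorProduct.rid ℂ A (LinearMap.lTensor A φ t)) =
      TensorProduct.rid ℂ A (LinearMap.lTensor A φ (Algebra.TensorProduct.map
        (α : A →⋆ₐ[ℂ] A).toAlgHom (α.symm : A →⋆ₐ[ℂ] A).toAlgHom t)) := fun t => by
    induction t with
    | zero => simp
    | add t t' h h' => simp only [map_add, h, h']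
    | tmul a b =>
      rw [Algebra.TensorProduct.map_tmul, LinearMap.lTensor_tmul, LinearMap.lTensor_tmul,
        TensorProduct.rid_tmul, TensorProduct.rid_tmul, map_smul]
      change φ b • α a = φ (α.symm b) • α a
      rw [← hφ (α.symm b), StarAlgEquiv.apply_symm_apply]
  have h := key (G.comul x)
  rw [map_aut_symm_comul hω hα] at h
  rw [mem_grade, zpow_zero, one_smul, h]

end Symmetry

/-! ### Haar states from diagonal integrals. -/

lemma lid_rTensor_sum (φ : Fin K → A →L[ℂ] ℂ) (c : ℂ) (t : A ⊗[ℂ] A) :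
    TensorProduct.lid ℂ A (LinearMap.rTensor A ((c • ∑ r, φ r : A →L[ℂ] ℂ) : A →ₗ[ℂ] ℂ) t) =
      c • ∑ r, TensorProduct.lid ℂ A (LinearMap.rTensor A (φ r : A →ₗ[ℂ] ℂ) t) := by
  induction t with
  | zero => simp
  | add t t' h h' => simp only [map_add, h, h', Finset.sum_add_distrib, smul_add]
  | tmul a b =>
    simp [Finset.sum_smul]

lemma rid_lTensor_sum (φ : Fin K → A →L[ℂ] ℂ) (c : ℂ) (t : A ⊗[ℂ] A) :
    TensorProduct.rid ℂ A (LinearMap.lTensor A ((c • ∑ r, φ r : A →L[ℂ] ℂ) : A →ₗ[ℂ] ℂ) t) =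
      c • ∑ r, TensorProduct.rid ℂ A (LinearMap.lTensor A (φ r : A →ₗ[ℂ] ℂ) t) := by
  induction t with
  | zero => simp
  | add t t' h h' => simp only [map_add, h, h', Finset.sum_add_distrib, smul_add]
  | tmul a b =>
    simp [Finset.sum_smul]

variable {G}

lemma isHaarState_average (hK : K ≠ 0) {φ : Fin K → A →L[ℂ] ℂ} (h : ∀ r, G.IsHaarState (φ r)) :
    G.IsHaarState ((K : ℂ)⁻¹ • ∑ r, φ r) := by
  have hKc : (K : ℂ) ≠ 0 := by exact_mod_cast hK
  refine ⟨⟨?_, fun a => ?_⟩, fun x => ⟨?_, ?_⟩⟩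
  · simp [(h _).1.1, hKc]
  · rw [smul_apply, sum_apply, smul_eq_mul]
    refine mul_nonneg ?_ (Finset.sum_nonneg fun r _ => (h r).1.2 a)
    rw [inv_nonneg]
    exact_mod_cast Nat.zero_le K
  · rw [lid_rTensor_sum, Finset.sum_congr rfl fun r _ => ((h r).2 x).1, ← Finset.sum_smul,
      smul_smul]
    simp
  · rw [rid_lTensor_sum, Finset.sum_congr rfl fun r _ => ((h r).2 x).2, ← Finset.sum_smul,
      smul_smul]
    simp

/-- The integrals of the diagonal coefficients of the model are invariant. -/
theorem isHaarState_diagIntegral (hK : K ≠ 0) (hA : G.IsArithmeticHalfLiberated K)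
    {α : A ≃⋆ₐ[ℂ] A} {ω : ℂ} (hω : IsPrimitiveRoot ω K)
    (hα : ∀ i j, α (G.u i j) = ω • G.u i j)
    (hG : ∃ (g : UnitaryPow N K) (ρ : _), G.IsModel g ρ)
    [MeasurableSpace (G.modelGroup hG)] [BorelSpace (G.modelGroup hG)]
    (μ : Measure (G.modelGroup hG)) [IsProbabilityMeasure μ] [μ.IsHaarMeasure] (r : Fin K) :
    G.IsHaarState (diagIntegral hG μ r) := by
  have hne := hω.ne_zero hK
  have hinv : ∀ a, (diagIntegral hG μ r : A →ₗ[ℂ] ℂ) (α a) =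
      (diagIntegral hG μ r : A →ₗ[ℂ] ℂ) a := fun a => by
    simp only [ContinuousLinearMap.coe_coe, diagIntegral_apply]
    congr 1
    ext g
    rw [(isModel_rep hG g).isCyclicRep.apply_aut hK hω hα, sub_self, zpow_zero, one_mul]
  -- Right translates of `μ` are again Haar probability measures, hence equal to `μ` by uniqueness.
  have hright : μ.IsMulRightInvariant := ⟨fun g => by
    have : IsProbabilityMeasure (μ.map (· * g)) :=
      Measure.isProbabilityMeasure_map (measurable_mul_const g).aemeasurable
    exact Measure.isHaarMeasure_eq_of_isProbabilityMeasure _ _⟩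
  have hscalar : ∀ c : ℂ, c • (1 : A) ∈ grade α ω 0 := fun c =>
    Submodule.smul_mem _ c one_mem_grade
  refine ⟨isState_diagIntegral hG μ r, fun x => ⟨?_, ?_⟩⟩
  -- Both sides lie in degree zero, so the `(r, r)` coefficients of cyclic representations decide.
  -- Each such representation is `rep hG g₀` for some `g₀`, and the claim becomes invariance of `μ`
  -- under right translation by `g₀`.
  · refine sub_eq_zero.1 (eq_zero_of_forall_isCyclicRep hK hA hω hα r
      (Submodule.sub_mem _ (lid_rTensor_comul_mem_grade hne hα hinv x) (hscalar _))
      fun ρ hρ => ?_)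
    obtain ⟨g, hg⟩ := hρ.exists_isModel
    obtain ⟨g₀, rfl⟩ : ∃ g₀, rep hG g₀ = ρ := ⟨⟨g, ρ, hg⟩, rep_eq_of_isModel hG hg⟩
    rw [map_sub, Matrix.sub_apply, rep_lid_rTensor]
    simp only [← rep_mul_apply]
    rw [integral_mul_right_eq_self (fun g => rep hG g x r r)]
    simp [diagIntegral_apply]
  · refine sub_eq_zero.1 (eq_zero_of_forall_isCyclicRep hK hA hω hα r
      (Submodule.sub_mem _ (rid_lTensor_comul_mem_grade hne hα hinv x) (hscalar _))
      fun ρ hρ => ?_)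
    obtain ⟨g, hg⟩ := hρ.exists_isModel
    obtain ⟨g₀, rfl⟩ : ∃ g₀, rep hG g₀ = ρ := ⟨⟨g, ρ, hg⟩, rep_eq_of_isModel hG hg⟩
    rw [map_sub, Matrix.sub_apply, rep_rid_lTensor]
    simp only [← rep_mul_apply]
    rw [integral_mul_left_eq_self (fun g => rep hG g x r r)]
    simp [diagIntegral_apply]

end CompactMatrixQuantumGroup

end QGroup

end

/-! ### Assembly of the group, the measure and the model. -/

theorem proposition4p6 {N K : ℕ} (hK : 1 ≤ K) {A : Type*} [CStarAlgebra A]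
    (G : QGroup.CompactMatrixQuantumGroup N A)
    (hG : G.IsArithmeticHalfLiberated K) (hsymm : G.IsSymmetric K) :
    ∃ L : Subgroup (QGroup.UnitaryPow N K),
      IsClosed (L : Set (QGroup.UnitaryPow N K)) ∧ QGroup.IsCyclicStable L ∧
      ∃ (_ : MeasurableSpace L) (_ : BorelSpace L) (μ : MeasureTheory.Measure L),
        MeasureTheory.IsProbabilityMeasure μ ∧ μ.IsHaarMeasure ∧
        ∃ π : A →⋆ₐ[ℂ] Matrix (Fin K) (Fin K) C(L, ℂ),
          (∀ i j, π (G.u i j) = QGroup.cycleMatrix fun r => QGroup.component L r i j) ∧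
          G.IsStationary μ π := by
  obtain ⟨α, hα⟩ := hsymm
  have hK0 : K ≠ 0 := by omega
  have hω := Complex.isPrimitiveRoot_exp K hK0
  -- If there were no cyclic representation, separation would give `1 = 0` in `A`, which the counit
  -- excludes.
  have hex : ∃ (g : QGroup.UnitaryPow N K) (ρ : _), G.IsModel g ρ := by
    by_contra hno
    have h1 : (1 : A) = 0 :=
      QGroup.CompactMatrixQuantumGroup.eq_zero_of_forall_isCyclicRep hK0 hG hω hα ⟨0, hK⟩
        QGroup.one_mem_grade fun ρ hρ => by
          obtain ⟨g, hg⟩ := hρ.exists_isModel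
          exact absurd ⟨g, ρ, hg⟩ hno
    simpa using congrArg G.counit h1
  let _ : MeasurableSpace (G.modelGroup hex) := borel _
  have _ : BorelSpace (G.modelGroup hex) := ⟨rfl⟩
  -- The group is compact, so the whole of it serves as the reference set of mass `1`.
  let μ : MeasureTheory.Measure (G.modelGroup hex) := MeasureTheory.Measure.haarMeasure ⊤
  have hμ : MeasureTheory.IsProbabilityMeasure μ :=
    ⟨MeasureTheory.Measure.haarMeasure_self (K₀ := ⊤)⟩
  have hμ' : μ.IsHaarMeasure := inferInstance
  refine ⟨G.modelGroup hex, QGroup.CompactMatrixQuantumGroup.isClosed_modelGroup hex,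
    QGroup.CompactMatrixQuantumGroup.isCyclicStable_modelGroup hex, _, ‹_›, μ, hμ, hμ',
    QGroup.CompactMatrixQuantumGroup.model hex,
    QGroup.CompactMatrixQuantumGroup.model_coord hex, _,
    QGroup.CompactMatrixQuantumGroup.isHaarState_average hK0 fun r =>
      QGroup.CompactMatrixQuantumGroup.isHaarState_diagIntegral hK0 hG hω hα hex μ r,
    fun a => ?_⟩
  rw [smul_apply, sum_apply, smul_eq_mul]
  rfl
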